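/- Let $U$ be a complex bialgebra (coproduct $h\mapsto h_{(1)}\otimes h_{(2)}$, counit $\epsilon$) and let $A$ be a unital complex algebra that is a left $U$-module algebra, i.e. a left $U$-module with $h\triangleright(ab)=(h_{(1)}\triangleright a)(h_{(2)}\triangleright b)$ and $h\triangleright 1=\epsilon(h)1$. **Equivariant K-theory.** Consider pairs $(e,\sigma)$, where $e\in\mathrm{Mat}_N(A)$ is idempotent ($N\ge 0$ arbitrary), $\sigma:U\to\mathrm{Mat}_N(\mathbb C)$ is a unital representation, and $(h_{(1)}\triangleright e)\,\sigma(h_{(2)})^t=\sigma(h)^t e$ for all $h\in U$. The associated equivariant projective module is $A^Ne=\{v\in A^N: ve=v\}$ with left multiplication by $A$ and $(h.v)_i=\sum_j (h_{(1)}\triangleright v_j)\,\sigma_{ij}(h_{(2)})$ for $h\in U$. Two pairs are equivalent if there is a bijection between their modules that is both $A$-linear and $U$-linear (an isomorphism of left $A\rtimes U$-modules). Let $V^U(A)$ be the abelian monoid of equivalence classes of pairs under direct sum, and $K_0^U(A)$ its Grothendieck group. **Equivariant cyclic homology.** For $n\ge 0$ let $C_n^U(A)$ be the space of linear maps $\omega:U\to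 A^{\otimes(n+1)}$ with $h_{(1)}\blacktriangleright\omega(xh_{(2)})=\omega(hx)$ for all $h,x\in U$, where $h\blacktriangleright(a_0\otimes\cdots\otimes a_n)=h_{(1)}\triangleright a_0\otimes\cdots\otimes h_{(n+1)}\triangleright a_n$. On linear maps $U\to A^{\otimes(n+1)}$ let $b_n=\sum_{i=0}^n(-1)^ib_{n,i}$ for $n\ge 1$ and $b_0=0$, where $$b_{n,i}(a_0\otimes\cdots\otimes a_n)(h)=(a_0\otimes\cdots\otimes a_ia_{i+1}\otimes\cdots\otimes a_n)(h)\quad(i<n),$$ $$b_{n,n}(a_0\otimes\cdots\otimes a_n)(h)=\bigl((h_{(1)}\triangleright a_n)a_0\otimes a_1\otimes\cdots\otimes a_{n-1}\bigr)(h_{(2)}),$$ and let $$\lambda_n(a_0\otimes\cdots\otimes a_n)(h)=(-1)^n\bigl((h_{(1)}\triangleright a_n)\otimes a_0\otimes\cdots\otimes a_{n-1}\bigr)(h_{(2)}).$$ Let $HC_n^U(A)$ be the $n$-th homology of the complex $C_\bullet^U(A)/(1-\lambda_\bullet)C_\bullet^U(A)$ with differential induced by $b$. **Theorem.** Let $n\ge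 0$. For every pair $(e,\sigma)$ as above, the map $\mathrm{Tr}_\sigma(e^{\otimes n+1}):U\to A^{\otimes(n+1)}$, $$\mathrm{Tr}_\sigma(e^{\otimes n+1})(h)=\sum_{i_0,\ldots,i_{n+1}=1}^{N} e_{i_0i_1}\otimes e_{i_1i_2}\otimes\cdots\otimes e_{i_ni_{n+1}}\;\sigma(h)_{i_0i_{n+1}},$$ belongs to $C_n^U(A)$ and represents a cycle in the above complex. There is a unique group homomorphism $\mathrm{ch}^n:K_0^U(A)\to HC_n^U(A)$ such that $\mathrm{ch}^n[(e,\sigma)]$ is the class of $\mathrm{Tr}_\sigma(e^{\otimes n+1})$ for every pair $(e,\sigma)$. -/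

import Mathlib

open scoped TensorProduct

noncomputable section

namespace EquivCyclic

universe u v

/-! ## Bialgebras, Sweedler notation, module algebras -/

section Sweedler

variable {U : Type u} [Ring U] [Bialgebra ℂ U]

/-- For a bilinear map `B` on `U`, `sweedler B h` is `B(h₍₁₎, h₍₂₎)`. -/
def sweedler {M : Type*} [AddCommGroup M] [Module ℂ M] (B : U →ₗ[ℂ] U →ₗ[ℂ] M) : U →ₗ[ℂ] M :=
  TensorProduct.lift B ∘ₗ Coalgebra.comul

theorem sweedler_eq_sum {M : Type*} [AddCommGroup M] [Module ℂ M] (B : U →ₗ[ℂ] U →ₗ[ℂ] M)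
    (h : U) {ι : Type*} (r : Coalgebra.Repr ℂ h ι) :
    sweedler B h = ∑ i ∈ r.index, B (r.left i) (r.right i) := by
  simp [sweedler, ← r.eq]

end Sweedler

/-- The action of a `ℂ`-algebra `U` on a left `U`-module `M`, as a linear map
`U → End_ℂ(M)`. -/
def actionMap (U : Type*) (M : Type*) [Ring U] [Algebra ℂ U] [AddCommGroup M] [Module ℂ M]
    [Module U M] [IsScalarTower ℂ U M] : U →ₗ[ℂ] M →ₗ[ℂ] M :=
  (Algebra.lsmul ℂ ℂ M : U →ₐ[ℂ] Module.End ℂ M).toLinearMap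

@[simp] theorem actionMap_apply (U : Type*) (M : Type*) [Ring U] [Algebra ℂ U] [AddCommGroup M]
    [Module ℂ M] [Module U M] [IsScalarTower ℂ U M] (h : U) (m : M) :
    actionMap U M h m = h • m := rfl

/-- `A`, a unital `ℂ`-algebra and a left `U`-module (the action `h ▷ a` is written `h • a`), is a
left `U`-module algebra: `h ▷ (ab) = (h₍₁₎ ▷ a)(h₍₂₎ ▷ b)` and `h ▷ 1 = ε(h) 1`. -/
class IsModuleAlgebra (U : Type u) (A : Type v) [Ring U] [Bialgebra ℂ U] [Ring A] [Algebra ℂ A]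
    [Module U A] [IsScalarTower ℂ U A] : Prop where
  smul_mul : ∀ (h : U) (a b : A),
    h • (a * b) = sweedler
      ((LinearMap.mul ℂ A).compl₁₂ ((actionMap U A).flip a) ((actionMap U A).flip b)) h
  smul_one : ∀ h : U, h • (1 : A) = algebraMap ℂ A (Coalgebra.counit h)

/-! ## Modules with actions of `A` and `U` -/

section Equivalence

/-- Two left modules over `A` and `U` are equivalent if there is an invertible map between them
that is linear over both, i.e. an isomorphism of left `A ⋊ U`-modules. -/
def ModuleEquivalent (U : Type u) (A : Type v) [Ring U] [Ring A] (E F : Type*) [AddCommGroup E] [Module A E] [Module U E] [AddCommGroup F]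
    [Module A F] [Module U F] : Prop :=
  ∃ φ : E ≃ₗ[A] F, ∀ (h : U) (x : E), φ (h • x) = h • φ x

namespace ModuleEquivalent

variable {U : Type u} {A : Type v} [Ring U] [Ring A] {E F G H : Type*} [AddCommGroup E] [Module A E] [Module U E] [AddCommGroup F]
    [Module A F] [Module U F] [AddCommGroup G] [Module A G] [Module U G] [AddCommGroup H]
    [Module A H] [Module U H]

theorem refl : ModuleEquivalent U A E E := ⟨LinearEquiv.refl A E, fun _ _ => rfl⟩

theorem symm (f : ModuleEquivalent U A E F) : ModuleEquivalent U A F E := by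
  obtain ⟨φ, hφ⟩ := f
  refine ⟨φ.symm, fun h x => ?_⟩
  rw [LinearEquiv.symm_apply_eq, hφ, LinearEquiv.apply_symm_apply]

theorem trans (f : ModuleEquivalent U A E F) (g : ModuleEquivalent U A F G) :
    ModuleEquivalent U A E G := by
  obtain ⟨φ, hφ⟩ := f
  obtain ⟨ψ, hψ⟩ := g
  exact ⟨φ.trans ψ, fun h x => by simp [hφ, hψ]⟩

theorem prodCongr (f : ModuleEquivalent U A E F) (g : ModuleEquivalent U A G H) :
    ModuleEquivalent U A (E × G) (F × H) := by
  obtain ⟨φ, hφ⟩ := f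
  obtain ⟨ψ, hψ⟩ := g
  exact ⟨LinearEquiv.prodCongr φ ψ, fun h x => by simp [hφ, hψ]⟩

theorem prodComm : ModuleEquivalent U A (E × F) (F × E) :=
  ⟨LinearEquiv.prodComm A E F, fun _ _ => rfl⟩

theorem prodAssoc : ModuleEquivalent U A ((E × F) × G) (E × F × G) :=
  ⟨LinearEquiv.prodAssoc A E F G, fun _ _ => rfl⟩

theorem zeroProd [Subsingleton E] : ModuleEquivalent U A (E × F) F := by
  refine ⟨{ LinearMap.snd A E F with
            invFun := fun x => (0, x)
            left_inv := fun x => Prod.ext (Subsingleton.elim _ _) rfl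
            right_inv := fun _ => rfl }, fun _ _ => rfl⟩

end ModuleEquivalent

end Equivalence

variable {U : Type u} {A : Type v} [Ring U] [Bialgebra ℂ U] [Ring A] [Algebra ℂ A]
  [Module U A] [IsScalarTower ℂ U A]

/-! ## Equivariant projective modules and equivariant K-theory -/

section KTheory

/-- Complex `N × N` matrices acting on columns with entries in `A`. -/
def matrixAction (A : Type v) [Ring A] [Algebra ℂ A] (N : ℕ) :
    Matrix (Fin N) (Fin N) ℂ →ₐ[ℂ] Module.End ℂ (Fin N → A) :=
  AlgHom.ofLinearMap
    { toFun := fun S =>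
        { toFun := fun v i => ∑ j, S i j • v j
          map_add' := fun v w => by ext i; simp [Finset.sum_add_distrib]
          map_smul' := fun c v => by
            ext i; simp [Finset.smul_sum, smul_comm _ c] }
      map_add' := fun S T => by ext v i; simp [add_smul, Finset.sum_add_distrib]
      map_smul' := fun c S => by ext v i; simp [Finset.smul_sum, smul_smul] }
    (by ext v i; simp [Matrix.one_apply])
    (fun S T => by
      refine LinearMap.ext fun v => funext fun i => ?_
      simp only [Matrix.mul_apply, LinearMap.coe_mk, AddHom.coe_mk, Module.End.mul_apply,
        Finset.sum_smul, Finset.smul_sum, mul_smul]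
      exact Finset.sum_comm)

@[simp] theorem matrixAction_apply {N : ℕ} (S : Matrix (Fin N) (Fin N) ℂ) (v : Fin N → A)
    (i : Fin N) : matrixAction A N S v i = ∑ j, S i j • v j := rfl

/-- The action of `U` on `A^N` determined by a representation `σ : U → Mat_N(ℂ)`:
`(h.v)_i = ∑_j (h₍₁₎ ▷ v_j) σ_{ij}(h₍₂₎)`. -/
def rowAction {N : ℕ} (σ : U →ₐ[ℂ] Matrix (Fin N) (Fin N) ℂ) :
    U →ₐ[ℂ] Module.End ℂ (Fin N → A) :=
  (Algebra.TensorProduct.lift (Algebra.lsmul ℂ ℂ (Fin N → A) : U →ₐ[ℂ] _)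
    ((matrixAction A N).comp σ)
    (fun h k => by
      refine LinearMap.ext fun v => funext fun i => ?_
      simp only [AlgHom.comp_apply, Module.End.mul_apply, matrixAction_apply, Algebra.lsmul_coe,
        Pi.smul_apply, Finset.smul_sum]
      exact Finset.sum_congr rfl fun j _ => smul_comm h _ _)).comp (Bialgebra.comulAlgHom ℂ U)

theorem rowAction_apply {N : ℕ} (σ : U →ₐ[ℂ] Matrix (Fin N) (Fin N) ℂ) (h : U) {ι : Type*}
    (r : Coalgebra.Repr ℂ h ι) (v : Fin N → A) (i : Fin N) :
    rowAction σ h v i = ∑ s ∈ r.index, ∑ j, σ (r.right s) i j • (r.left s • v j) := by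
  simp only [rowAction, AlgHom.comp_apply, Bialgebra.comulAlgHom_apply]
  rw [← r.eq, map_sum, LinearMap.sum_apply, Finset.sum_apply]
  refine Finset.sum_congr rfl fun s _ => ?_
  change r.left s • (∑ j, σ (r.right s) i j • v j) = _
  rw [Finset.smul_sum]
  exact Finset.sum_congr rfl fun j _ => smul_comm _ _ _

/-- For a matrix `T` with entries in `A`, the matrix `(h₍₁₎ ▷ T) σ(h₍₂₎)ᵗ`. -/
def twistedAction {M N : ℕ} (σ : U →ₐ[ℂ] Matrix (Fin N) (Fin N) ℂ) (h : U)
    (T : Matrix (Fin M) (Fin N) A) : Matrix (Fin M) (Fin N) A :=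
  Matrix.of fun i => rowAction σ h (T i)

theorem twistedAction_eq_sum {M N : ℕ} (σ : U →ₐ[ℂ] Matrix (Fin N) (Fin N) ℂ) (h : U)
    {ι : Type*} (r : Coalgebra.Repr ℂ h ι) (T : Matrix (Fin M) (Fin N) A) :
    twistedAction σ h T =
      ∑ s ∈ r.index, (T.map (r.left s • ·)) * (σ (r.right s)).transpose.map (algebraMap ℂ A) := by
  ext i k
  simp only [twistedAction, Matrix.of_apply, rowAction_apply σ h r, Matrix.sum_apply,
    Matrix.mul_apply, Matrix.map_apply, Matrix.transpose_apply]
  refine Finset.sum_congr rfl fun s _ => Finset.sum_congr rfl fun j _ => ?_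
  rw [Algebra.smul_def, Algebra.commutes]

variable (U A) in
/-- A pair `(e, σ)`: an idempotent `e ∈ Mat_N(A)` and a representation `σ : U → Mat_N(ℂ)` with
`(h₍₁₎ ▷ e) σ(h₍₂₎)ᵗ = σ(h)ᵗ e` for all `h`. -/
structure EquivariantIdempotent where
  N : ℕ
  e : Matrix (Fin N) (Fin N) A
  σ : U →ₐ[ℂ] Matrix (Fin N) (Fin N) ℂ
  idem : e * e = e
  equivariant : ∀ h : U, twistedAction σ h e = (σ h).transpose.map (algebraMap ℂ A) * e

namespace EquivariantIdempotent

theorem rowAction_row (p : EquivariantIdempotent U A) (h : U) (i : Fin p.N) :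
    rowAction p.σ h (p.e i) = ∑ j, p.σ h j i • p.e j := by
  have := congrFun (p.equivariant h) i
  ext k
  have := congrFun this k
  simpa [twistedAction, Matrix.mul_apply, Algebra.smul_def] using this

/-- `A^N e = {v ∈ A^N : v e = v}` as a left `A`-submodule of `A^N`. -/
def range (p : EquivariantIdempotent U A) : Submodule A (Fin p.N → A) where
  carrier := {v | Matrix.vecMul v p.e = v}
  add_mem' := fun {v w} hv hw => by
    simp only [Set.mem_ofPred_eq] at *
    rw [Matrix.add_vecMul, hv, hw]
  zero_mem' := by simp
  smul_mem' := fun a v hv => by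
    simp only [Set.mem_ofPred_eq] at *
    rw [Matrix.smul_vecMul, hv]

theorem mem_range (p : EquivariantIdempotent U A) (v : Fin p.N → A) :
    v ∈ p.range ↔ Matrix.vecMul v p.e = v := Iff.rfl

theorem row_mem_range (p : EquivariantIdempotent U A) (i : Fin p.N) : p.e i ∈ p.range :=
  congrFun p.idem i

end EquivariantIdempotent

/-- `h.(a v) = (h₍₁₎ ▷ a)(h₍₂₎.v)`: together, the actions of `A` and `U` on `A^N` are an action of
the smash product `A ⋊ U`. -/
theorem rowAction_smul [IsModuleAlgebra U A] {N : ℕ} (σ : U →ₐ[ℂ] Matrix (Fin N) (Fin N) ℂ)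
    (h : U) {ι : Type*} (r : Coalgebra.Repr ℂ h ι) (a : A) (v : Fin N → A) :
    rowAction σ h (a • v) = ∑ s ∈ r.index, (r.left s • a) • rowAction σ (r.right s) v := by
  ext i
  have key := Coalgebra.sum_tmul_tmul_eq r (fun s => Coalgebra.Repr.arbitrary ℂ (r.left s))
    (fun s => Coalgebra.Repr.arbitrary ℂ (r.right s))
  have key2 := fun j => congrArg (TensorProduct.lift (LinearMap.compl₁₂ (LinearMap.mul ℂ A)
    ((actionMap U A).flip a) (TensorProduct.lift (LinearMap.compl₁₂ (LinearMap.lsmul ℂ A).flip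
      ((actionMap U A).flip (v j)) (Matrix.entryLinearMap ℂ ℂ i j ∘ₗ σ.toLinearMap))))) key
  simp only [map_sum, TensorProduct.lift.tmul, LinearMap.compl₁₂_apply, LinearMap.flip_apply,
    actionMap_apply, LinearMap.lsmul_apply, LinearMap.mul_apply', LinearMap.comp_apply,
    AlgHom.toLinearMap_apply, Matrix.entryLinearMap_apply] at key2
  rw [rowAction_apply σ h r]
  simp only [Finset.sum_apply, Pi.smul_apply, smul_eq_mul]
  have hl : ∀ s, ∀ j, σ (r.right s) i j • (r.left s • (a * v j)) =
      ∑ x ∈ (Coalgebra.Repr.arbitrary ℂ (r.left s)).index,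
        ((Coalgebra.Repr.arbitrary ℂ (r.left s)).left x • a) * (σ (r.right s) i j •
          ((Coalgebra.Repr.arbitrary ℂ (r.left s)).right x • v j)) := by
    intro s j
    rw [IsModuleAlgebra.smul_mul,
      sweedler_eq_sum _ _ (Coalgebra.Repr.arbitrary ℂ (r.left s)), Finset.smul_sum]
    simp
  simp only [hl]
  rw [Finset.sum_comm]
  simp only [key2]
  rw [Finset.sum_comm]
  refine Finset.sum_congr rfl fun s _ => ?_
  rw [rowAction_apply σ _ (Coalgebra.Repr.arbitrary ℂ (r.right s)), Finset.mul_sum,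
    Finset.sum_comm]
  simp only [Finset.mul_sum]

namespace EquivariantIdempotent

theorem rowAction_mem_range [IsModuleAlgebra U A] (p : EquivariantIdempotent U A) (h : U)
    {v : Fin p.N → A} (hv : v ∈ p.range) : rowAction p.σ h v ∈ p.range := by
  have hv' : v = ∑ i, v i • p.e i := by
    conv_lhs => rw [← (p.mem_range v).1 hv]
    ext k
    simp [Matrix.vecMul, dotProduct]
  rw [hv', map_sum]
  refine Submodule.sum_mem _ fun i _ => ?_
  rw [rowAction_smul p.σ h (Coalgebra.Repr.arbitrary ℂ h)]
  refine Submodule.sum_mem _ fun s _ => Submodule.smul_mem _ _ ?_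
  rw [rowAction_row]
  refine Submodule.sum_mem _ fun j _ => ?_
  rw [← algebraMap_smul A]
  exact Submodule.smul_mem _ _ (p.row_mem_range j)

/-- The equivariant projective module `A^N e`, with its left actions of `A` and of `U`. -/
def Mod (p : EquivariantIdempotent U A) : Type v := p.range

instance (p : EquivariantIdempotent U A) : AddCommGroup p.Mod :=
  inferInstanceAs (AddCommGroup p.range)

instance (p : EquivariantIdempotent U A) : Module A p.Mod :=
  inferInstanceAs (Module A p.range)

instance [IsModuleAlgebra U A] (p : EquivariantIdempotent U A) : Module U p.Mod where
  smul h v := ⟨rowAction p.σ h v.1, p.rowAction_mem_range h v.2⟩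
  one_smul v := Subtype.ext (show rowAction p.σ 1 v.1 = v.1 by simp)
  mul_smul h k v := Subtype.ext
    (show rowAction p.σ (h * k) v.1 = rowAction p.σ h (rowAction p.σ k v.1) by simp)
  smul_zero h := Subtype.ext (show rowAction p.σ h (0 : Fin p.N → A) = 0 by simp)
  smul_add h v w := Subtype.ext
    (show rowAction p.σ h (v.1 + w.1) = rowAction p.σ h v.1 + rowAction p.σ h w.1 by simp)
  add_smul h k v := Subtype.ext
    (show rowAction p.σ (h + k) v.1 = rowAction p.σ h v.1 + rowAction p.σ k v.1 by simp)
  zero_smul v := Subtype.ext (show rowAction p.σ (0 : U) v.1 = 0 by simp)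

theorem smul_val [IsModuleAlgebra U A] (p : EquivariantIdempotent U A) (h : U) (v : p.Mod) :
    (h • v).1 = rowAction p.σ h v.1 := rfl

end EquivariantIdempotent

section DirectSum

variable {M N : ℕ}

/-- Block-diagonal sum of square matrices. -/
def blockSum {R : Type*} [Zero R] (S : Matrix (Fin M) (Fin M) R) (T : Matrix (Fin N) (Fin N) R) :
    Matrix (Fin (M + N)) (Fin (M + N)) R :=
  Matrix.reindex finSumFinEquiv finSumFinEquiv (Matrix.fromBlocks S 0 0 T)

section

variable {R : Type*} [Zero R] (S : Matrix (Fin M) (Fin M) R) (T : Matrix (Fin N) (Fin N) R)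

@[simp] theorem blockSum_ll (i j : Fin M) :
    blockSum S T (Fin.castAdd N i) (Fin.castAdd N j) = S i j := by simp [blockSum]

@[simp] theorem blockSum_lr (i : Fin M) (j : Fin N) :
    blockSum S T (Fin.castAdd N i) (Fin.natAdd M j) = 0 := by simp [blockSum]

@[simp] theorem blockSum_rl (i : Fin N) (j : Fin M) :
    blockSum S T (Fin.natAdd M i) (Fin.castAdd N j) = 0 := by simp [blockSum]

@[simp] theorem blockSum_rr (i j : Fin N) :
    blockSum S T (Fin.natAdd M i) (Fin.natAdd M j) = T i j := by simp [blockSum]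

end

/-- Extensionality for matrices of size `M + N`. -/
theorem block_ext {R : Type*} {S T : Matrix (Fin (M + N)) (Fin (M + N)) R}
    (h1 : ∀ i j, S (Fin.castAdd N i) (Fin.castAdd N j) = T (Fin.castAdd N i) (Fin.castAdd N j))
    (h2 : ∀ i j, S (Fin.castAdd N i) (Fin.natAdd M j) = T (Fin.castAdd N i) (Fin.natAdd M j))
    (h3 : ∀ i j, S (Fin.natAdd M i) (Fin.castAdd N j) = T (Fin.natAdd M i) (Fin.castAdd N j))
    (h4 : ∀ i j, S (Fin.natAdd M i) (Fin.natAdd M j) = T (Fin.natAdd M i) (Fin.natAdd M j)) :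
    S = T := by
  ext i j
  refine Fin.addCases (fun i => ?_) (fun i => ?_) i <;>
    refine Fin.addCases (fun j => ?_) (fun j => ?_) j
  exacts [h1 i j, h2 i j, h3 i j, h4 i j]

theorem blockSum_mul {R : Type*} [Ring R] (S S' : Matrix (Fin M) (Fin M) R)
    (T T' : Matrix (Fin N) (Fin N) R) :
    blockSum S T * blockSum S' T' = blockSum (S * S') (T * T') := by
  apply block_ext <;> intro i j <;> simp [Matrix.mul_apply, Fin.sum_univ_add]

/-- Direct sum of two matrix representations. -/
def repSum (σ : U →ₐ[ℂ] Matrix (Fin M) (Fin M) ℂ) (τ : U →ₐ[ℂ] Matrix (Fin N) (Fin N) ℂ) :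
    U →ₐ[ℂ] Matrix (Fin (M + N)) (Fin (M + N)) ℂ :=
  AlgHom.ofLinearMap
    { toFun := fun h => blockSum (σ h) (τ h)
      map_add' := fun h k => by apply block_ext <;> intro i j <;> simp
      map_smul' := fun c h => by apply block_ext <;> intro i j <;> simp }
    (by apply block_ext <;> intro i j <;>
          simp [Matrix.one_apply, Fin.ext_iff] <;> omega)
    (fun h k => by simp [blockSum_mul])

theorem repSum_apply (σ : U →ₐ[ℂ] Matrix (Fin M) (Fin M) ℂ)
    (τ : U →ₐ[ℂ] Matrix (Fin N) (Fin N) ℂ) (h : U) :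
    repSum σ τ h = blockSum (σ h) (τ h) := rfl

theorem rowAction_repSum_left (σ : U →ₐ[ℂ] Matrix (Fin M) (Fin M) ℂ)
    (τ : U →ₐ[ℂ] Matrix (Fin N) (Fin N) ℂ) (h : U) (v : Fin (M + N) → A) (i : Fin M) :
    rowAction (repSum σ τ) h v (Fin.castAdd N i) =
      rowAction σ h (fun j => v (Fin.castAdd N j)) i := by
  rw [rowAction_apply _ h (Coalgebra.Repr.arbitrary ℂ h),
    rowAction_apply _ h (Coalgebra.Repr.arbitrary ℂ h)]
  simp [repSum_apply, Fin.sum_univ_add]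

theorem rowAction_repSum_right (σ : U →ₐ[ℂ] Matrix (Fin M) (Fin M) ℂ)
    (τ : U →ₐ[ℂ] Matrix (Fin N) (Fin N) ℂ) (h : U) (v : Fin (M + N) → A) (i : Fin N) :
    rowAction (repSum σ τ) h v (Fin.natAdd M i) =
      rowAction τ h (fun j => v (Fin.natAdd M j)) i := by
  rw [rowAction_apply _ h (Coalgebra.Repr.arbitrary ℂ h),
    rowAction_apply _ h (Coalgebra.Repr.arbitrary ℂ h)]
  simp [repSum_apply, Fin.sum_univ_add]

namespace EquivariantIdempotent

theorem equivariant_apply (p : EquivariantIdempotent U A) (h : U) (i k : Fin p.N) :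
    rowAction p.σ h (fun j => p.e i j) k = ∑ j, p.σ h j i • p.e j k := by
  have := congrFun (p.rowAction_row h i) k
  simpa using this

/-- The direct sum `(e ⊕ f, σ ⊕ τ)`. -/
def directSum (p q : EquivariantIdempotent U A) : EquivariantIdempotent U A where
  N := p.N + q.N
  e := blockSum p.e q.e
  σ := repSum p.σ q.σ
  idem := by rw [blockSum_mul, p.idem, q.idem]
  equivariant h := by
    apply block_ext <;> intro i j <;>
      simp only [twistedAction, Matrix.of_apply, rowAction_repSum_left, rowAction_repSum_right,
        blockSum_ll, blockSum_lr, blockSum_rl, blockSum_rr, equivariant_apply, Matrix.mul_apply,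
        Matrix.map_apply, Matrix.transpose_apply, repSum_apply, Fin.sum_univ_add, map_zero,
        zero_mul, mul_zero, Finset.sum_const_zero, add_zero, zero_add, Algebra.smul_def]
    · exact congrFun (map_zero (rowAction q.σ h)) j
    · exact congrFun (map_zero (rowAction p.σ h)) j

/-- The pair with `N = 0`. -/
def zero : EquivariantIdempotent U A where
  N := 0
  e := 0
  σ := AlgHom.ofLinearMap 0 (Subsingleton.elim _ _) (fun _ _ => Subsingleton.elim _ _)
  idem := Subsingleton.elim _ _
  equivariant _ := Subsingleton.elim _ _

variable [IsModuleAlgebra U A]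

/-- The module of `e ⊕ f` is the direct sum of the modules of `e` and of `f`. -/
theorem directSum_equivalent (p q : EquivariantIdempotent U A) :
    ModuleEquivalent U A (p.directSum q).Mod (p.Mod × q.Mod) := by
  have h1 : ∀ v : Fin (p.N + q.N) → A, Matrix.vecMul v (blockSum p.e q.e) = v ↔
      Matrix.vecMul (fun j => v (Fin.castAdd q.N j)) p.e = (fun j => v (Fin.castAdd q.N j)) ∧
      Matrix.vecMul (fun j => v (Fin.natAdd p.N j)) q.e = (fun j => v (Fin.natAdd p.N j)) := by
    intro v
    constructor
    · intro hv
      constructor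
      · ext k
        have := congrFun hv (Fin.castAdd q.N k)
        simpa [Matrix.vecMul, dotProduct, Fin.sum_univ_add] using this
      · ext k
        have := congrFun hv (Fin.natAdd p.N k)
        simpa [Matrix.vecMul, dotProduct, Fin.sum_univ_add] using this
    · rintro ⟨hl, hr⟩
      ext k
      refine Fin.addCases (fun k => ?_) (fun k => ?_) k
      · have := congrFun hl k
        simpa [Matrix.vecMul, dotProduct, Fin.sum_univ_add] using this
      · have := congrFun hr k
        simpa [Matrix.vecMul, dotProduct, Fin.sum_univ_add] using this
  refine ⟨{ toFun := fun v => (⟨fun j => v.1 (Fin.castAdd q.N j), ((h1 v.1).1 v.2).1⟩,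
              ⟨fun j => v.1 (Fin.natAdd p.N j), ((h1 v.1).1 v.2).2⟩)
            map_add' := fun v w => rfl
            map_smul' := fun a v => rfl
            invFun := fun w => ⟨Fin.append w.1.1 w.2.1, (h1 _).2 ⟨by
                have := w.1.2
                rw [mem_range] at this
                simpa using this, by
                have := w.2.2
                rw [mem_range] at this
                simpa using this⟩⟩
            left_inv := fun v => Subtype.ext (by
              funext k
              refine Fin.addCases (fun k => ?_) (fun k => ?_) k <;> simp)
            right_inv := fun w => Prod.ext (Subtype.ext (by funext k; simp))
              (Subtype.ext (by funext k; simp)) }, fun h v => ?_⟩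
  refine Prod.ext (Subtype.ext ?_) (Subtype.ext ?_)
  · funext k
    exact rowAction_repSum_left p.σ q.σ h v.1 k
  · funext k
    exact rowAction_repSum_right p.σ q.σ h v.1 k

instance : Subsingleton (zero : EquivariantIdempotent U A).Mod :=
  ⟨fun _ _ => Subtype.ext (Subsingleton.elim (α := Fin 0 → A) _ _)⟩

variable (U A) in
/-- Equivalence of pairs: isomorphism of the modules `A^N e` and `A^N' e'` as left
`A ⋊ U`-modules. -/
instance setoid : Setoid (EquivariantIdempotent U A) where
  r p q := ModuleEquivalent U A p.Mod q.Mod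
  iseqv := ⟨fun _ => .refl, .symm, .trans⟩

end EquivariantIdempotent

end DirectSum

variable (U A) in
/-- The monoid `V^U(A)` of equivalence classes of equivariant projective modules. -/
def V [IsModuleAlgebra U A] : Type (max u v) := Quotient (EquivariantIdempotent.setoid U A)

namespace V

variable [IsModuleAlgebra U A]

/-- The class of a pair `(e, σ)`. -/
def mk (p : EquivariantIdempotent U A) : V U A := Quotient.mk _ p

theorem mk_eq_mk (p q : EquivariantIdempotent U A) :
    mk p = mk q ↔ ModuleEquivalent U A p.Mod q.Mod := Quotient.eq

/-- Addition is induced by the direct sum. -/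
instance : Add (V U A) where
  add := Quotient.map₂ EquivariantIdempotent.directSum fun p p' hp q q' hq =>
    (p.directSum_equivalent q).trans
      ((ModuleEquivalent.prodCongr hp hq).trans (p'.directSum_equivalent q').symm)

instance : Zero (V U A) := ⟨mk .zero⟩

theorem mk_add_mk (p q : EquivariantIdempotent U A) : mk p + mk q = mk (p.directSum q) := rfl

theorem add_comm' (x y : V U A) : x + y = y + x := by
  induction x using Quotient.inductionOn with | _ p
  induction y using Quotient.inductionOn with | _ q
  exact Quotient.sound ((p.directSum_equivalent q).trans
    (ModuleEquivalent.prodComm.trans (q.directSum_equivalent p).symm))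

theorem zero_add' (x : V U A) : 0 + x = x := by
  induction x using Quotient.inductionOn with | _ p
  exact Quotient.sound ((EquivariantIdempotent.directSum_equivalent _ p).trans .zeroProd)

instance : AddCommMonoid (V U A) where
  add_assoc x y z := by
    induction x using Quotient.inductionOn with | _ p
    induction y using Quotient.inductionOn with | _ q
    induction z using Quotient.inductionOn with | _ r
    exact Quotient.sound (((p.directSum q).directSum_equivalent r).trans
      (((p.directSum_equivalent q).prodCongr .refl).trans (ModuleEquivalent.prodAssoc.trans
        ((ModuleEquivalent.refl.prodCongr (q.directSum_equivalent r).symm).trans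
          (p.directSum_equivalent (q.directSum r)).symm))))
  zero_add := zero_add'
  add_zero x := (add_comm' x 0).trans (zero_add' x)
  add_comm := add_comm'
  nsmul := nsmulRec

end V

variable (U A) in
/-- The equivariant K-theory group `K₀^U(A)`: the Grothendieck group of `V^U(A)`. -/
abbrev K0 [IsModuleAlgebra U A] : Type (max u v) := Algebra.GrothendieckAddGroup (V U A)

/-- The class `[(e, σ)]` in `K₀^U(A)`. -/
def K0.of [IsModuleAlgebra U A] (p : EquivariantIdempotent U A) : K0 U A :=
  Algebra.GrothendieckAddGroup.of (V.mk p)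

end KTheory

/-! ## Equivariant cyclic homology -/

section CyclicHomology

/-- `A^{⊗ n}`, the tensor power over `ℂ`. -/
def TPow (A : Type v) [Ring A] [Algebra ℂ A] (n : ℕ) : Type v := ⨂[ℂ] _i : Fin n, A

instance (n : ℕ) : AddCommGroup (TPow A n) :=
  inferInstanceAs (AddCommGroup (⨂[ℂ] _i : Fin n, A))

instance (n : ℕ) : Module ℂ (TPow A n) := inferInstanceAs (Module ℂ (⨂[ℂ] _i : Fin n, A))

/-- `(a₀, …, a_{n-1}) ↦ a₀ ⊗ ⋯ ⊗ a_{n-1}`. -/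
def tprod (n : ℕ) : MultilinearMap ℂ (fun _ : Fin n => A) (TPow A n) := PiTensorProduct.tprod ℂ

/-- The linear map on `A^{⊗ n}` induced by a multilinear map. -/
def TPow.lift {M : Type*} [AddCommGroup M] [Module ℂ M] {n : ℕ}
    (f : MultilinearMap ℂ (fun _ : Fin n => A) M) : TPow A n →ₗ[ℂ] M := PiTensorProduct.lift f

@[simp] theorem TPow.lift_tprod {M : Type*} [AddCommGroup M] [Module ℂ M] {n : ℕ}
    (f : MultilinearMap ℂ (fun _ : Fin n => A) M) (a : Fin n → A) :
    TPow.lift f (tprod n a) = f a := PiTensorProduct.lift.tprod a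

theorem TPow.hom_ext {M : Type*} [AddCommGroup M] [Module ℂ M] {n : ℕ} {f g : TPow A n →ₗ[ℂ] M}
    (h : ∀ a, f (tprod n a) = g (tprod n a)) : f = g :=
  PiTensorProduct.ext (MultilinearMap.ext h)

variable (U A) in
/-- `Hom_ℂ(U, A^{⊗ (n+1)})`. -/
abbrev Chain (n : ℕ) : Type (max u v) := U →ₗ[ℂ] TPow A (n + 1)

theorem update_apply_apply {n : ℕ} (i : Fin n) (f : A →ₗ[ℂ] A) (a : Fin n → A) :
    (fun j => Function.update (fun _ : Fin n => (LinearMap.id : A →ₗ[ℂ] A)) i f j (a j)) =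
      Function.update a i (f (a i)) := by
  ext j
  rcases eq_or_ne j i with rfl | hj
  · simp
  · simp [hj]

/-- `U` acting on the `i`-th factor of `A^{⊗ n}` only. -/
def factorAction (n : ℕ) (i : Fin n) : U →ₗ[ℂ] TPow A n →ₗ[ℂ] TPow A n where
  toFun h := TPow.lift ((tprod n).compLinearMap
    (Function.update (fun _ => LinearMap.id) i (actionMap U A h)))
  map_add' h k := TPow.hom_ext fun a => by
    simp only [LinearMap.add_apply, TPow.lift_tprod, MultilinearMap.compLinearMap_apply,
      update_apply_apply, map_add, MultilinearMap.map_update_add]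
  map_smul' c h := TPow.hom_ext fun a => by
    simp only [LinearMap.smul_apply, TPow.lift_tprod, MultilinearMap.compLinearMap_apply,
      update_apply_apply, map_smul, MultilinearMap.map_update_smul, RingHom.id_apply]

theorem factorAction_tprod (n : ℕ) (i : Fin n) (h : U) (a : Fin n → A) :
    factorAction n i h (tprod n a) = tprod n (Function.update a i (h • a i)) := by
  change TPow.lift _ (tprod n a) = _
  rw [TPow.lift_tprod, MultilinearMap.compLinearMap_apply, update_apply_apply, actionMap_apply]

/-- `a₀ ⊗ ⋯ ⊗ a_{k-1} ⊗ a_k ⊗ ⋯ ↦ h₍₁₎ ▷ a₀ ⊗ ⋯ ⊗ h₍ₖ₎ ▷ a_{k-1} ⊗ a_k ⊗ ⋯` on `A^{⊗ n}`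
(the first `k` factors, `k ≤ n`; for `k = 0` it is multiplication by `ε(h)`). -/
def partialDiagonalAction (n : ℕ) : ∀ k : ℕ, k ≤ n → (U →ₗ[ℂ] TPow A n →ₗ[ℂ] TPow A n)
  | 0, _ => (Coalgebra.counit (R := ℂ) (A := U)).smulRight LinearMap.id
  | k + 1, hk => sweedler ((LinearMap.mul ℂ (Module.End ℂ (TPow A n))).compl₁₂
      (partialDiagonalAction n k (Nat.le_of_succ_le hk)) (factorAction n ⟨k, hk⟩))

/-- The diagonal action
`h ▸ (a₀ ⊗ ⋯ ⊗ a_{n-1}) = h₍₁₎ ▷ a₀ ⊗ ⋯ ⊗ h₍ₙ₎ ▷ a_{n-1}` on `A^{⊗ n}`. -/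
def diagonalAction (n : ℕ) : U →ₗ[ℂ] TPow A n →ₗ[ℂ] TPow A n :=
  partialDiagonalAction n n le_rfl

/-- The rotation `a₀ ⊗ ⋯ ⊗ a_n ↦ a_n ⊗ a₀ ⊗ ⋯ ⊗ a_{n-1}`. -/
def rotate (A : Type v) [Ring A] [Algebra ℂ A] (n : ℕ) : TPow A (n + 1) →ₗ[ℂ] TPow A (n + 1) :=
  TPow.lift ((tprod (n + 1)).domDomCongr (finRotate (n + 1)).symm)

theorem rotate_tprod (n : ℕ) (a : Fin (n + 1) → A) :
    rotate A n (tprod (n + 1) a) =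
      tprod (n + 1) (Fin.cons (a (Fin.last n)) (Fin.init a)) := by
  rw [rotate, TPow.lift_tprod, MultilinearMap.domDomCongr_apply]
  congr 1
  ext j
  refine Fin.cases ?_ (fun j => ?_) j
  · simp only [Fin.cons_zero]
    congr 1
  · simp only [Fin.cons_succ, Fin.init]
    congr 1
    rw [Equiv.symm_apply_eq]
    simp

/-- `(a₀ ⊗ ⋯ ⊗ a_n)(h) ↦ (h₍₁₎ ▷ a_n ⊗ a₀ ⊗ ⋯ ⊗ a_{n-1})(h₍₂₎)`, the cyclic operator
without its sign. -/
def twistedRotate (n : ℕ) : Chain U A n →ₗ[ℂ] Chain U A n where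
  toFun ω := sweedler ((factorAction (n + 1) 0).compl₂ (rotate A n ∘ₗ ω))
  map_add' ω η := by
    ext h
    simp [sweedler_eq_sum _ h (Coalgebra.Repr.arbitrary ℂ h), Finset.sum_add_distrib]
  map_smul' c ω := by
    ext h
    simp [sweedler_eq_sum _ h (Coalgebra.Repr.arbitrary ℂ h), Finset.smul_sum]

theorem twistedRotate_apply (n : ℕ) (ω : Chain U A n) (h : U) {ι : Type*}
    (r : Coalgebra.Repr ℂ h ι) :
    twistedRotate n ω h =
      ∑ s ∈ r.index, factorAction (n + 1) 0 (r.left s) (rotate A n (ω (r.right s))) :=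
  sweedler_eq_sum _ h r

/-- The cyclic operator `λ_n`. -/
def cyclicOperator (n : ℕ) : Chain U A n →ₗ[ℂ] Chain U A n :=
  (-1 : ℂ) ^ n • twistedRotate n

/-- `(a₀, …, a_{n+1}) ↦ (a₀, …, a_i a_{i+1}, …, a_{n+1})` for `0 ≤ i ≤ n`. -/
def contractFun {n : ℕ} (i : Fin (n + 1)) (a : Fin (n + 2) → A) (k : Fin (n + 1)) : A :=
  if k < i then a k.castSucc else if k = i then a k.castSucc * a k.succ else a k.succ

theorem contractFun_update {n : ℕ} (i : Fin (n + 1)) (a : Fin (n + 2) → A) (j : Fin (n + 2))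
    (z : A) : contractFun i (Function.update a j z) =
      Function.update (contractFun i a) (i.predAbove j)
        (if j = i.castSucc then z * a i.succ else if j = i.succ then a i.castSucc * z else z) := by
  have hp : ((i.predAbove j : Fin (n + 1)) : ℕ) = if (i : ℕ) < j then (j : ℕ) - 1 else j := by
    rcases lt_or_ge i.castSucc j with h | h
    · rw [Fin.predAbove_of_castSucc_lt _ _ h, Fin.val_pred, if_pos (by simpa [Fin.lt_def] using h)]
    · rw [Fin.predAbove_of_le_castSucc _ _ h, Fin.coe_castPred,
        if_neg (by simpa [Fin.le_def] using h)]
  ext k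
  simp only [contractFun, Function.update_apply, Fin.ext_iff, Fin.lt_def, hp, Fin.val_castSucc,
    Fin.val_succ]
  grind

/-- `a₀ ⊗ ⋯ ⊗ a_{n+1} ↦ a₀ ⊗ ⋯ ⊗ a_i a_{i+1} ⊗ ⋯ ⊗ a_{n+1}` for `0 ≤ i ≤ n`. -/
def contract (A : Type v) [Ring A] [Algebra ℂ A] (n : ℕ) (i : Fin (n + 1)) :
    TPow A (n + 2) →ₗ[ℂ] TPow A (n + 1) :=
  TPow.lift
    { toFun := fun a => tprod (n + 1) (contractFun i a)
      map_update_add' := fun {inst} a j x y => by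
        rw [Subsingleton.elim inst (instDecidableEqFin _)]
        simp only [contractFun_update]
        rw [← MultilinearMap.map_update_add]
        congr 2
        split_ifs <;> simp [add_mul, mul_add]
      map_update_smul' := fun {inst} a j c x => by
        rw [Subsingleton.elim inst (instDecidableEqFin _)]
        simp only [contractFun_update]
        rw [← MultilinearMap.map_update_smul]
        congr 2
        split_ifs <;> simp }

theorem contract_tprod (n : ℕ) (i : Fin (n + 1)) (a : Fin (n + 2) → A) :
    contract A n i (tprod (n + 2) a) = tprod (n + 1) (contractFun i a) :=
  TPow.lift_tprod _ _

/-- The face operators `b_{n+1,i}` for `i = 0, …, n`, and `b_{n+1,n+1}`, which is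
`(a₀ ⊗ ⋯ ⊗ a_{n+1})(h) ↦ ((h₍₁₎ ▷ a_{n+1}) a₀ ⊗ a₁ ⊗ ⋯ ⊗ a_n)(h₍₂₎)`. -/
def face (n : ℕ) (i : Fin (n + 2)) : Chain U A (n + 1) →ₗ[ℂ] Chain U A n :=
  if hi : i.val < n + 1 then LinearMap.compRight ℂ (contract A n ⟨i.val, hi⟩)
  else LinearMap.compRight ℂ (contract A n 0) ∘ₗ twistedRotate (n + 1)

/-- The boundary operator `b_{n+1} = ∑ (-1)^i b_{n+1,i}`. -/
def boundary (n : ℕ) : Chain U A (n + 1) →ₗ[ℂ] Chain U A n :=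
  ∑ i : Fin (n + 2), (-1 : ℂ) ^ (i : ℕ) • face n i

variable (U A) in
/-- `C_n^U(A)`: the chains `ω` with `h₍₁₎ ▸ ω(x h₍₂₎) = ω(h x)` for all `h, x ∈ U`. -/
def equivariantChains (n : ℕ) : Submodule ℂ (Chain U A n) where
  carrier := {ω | ∀ h x : U,
    sweedler ((diagonalAction (n + 1)).compl₂ (ω ∘ₗ LinearMap.mulLeft ℂ x)) h = ω (h * x)}
  add_mem' := fun {ω η} hω hη h x => by
    rw [LinearMap.add_apply, ← hω h x, ← hη h x]
    simp [sweedler_eq_sum _ h (Coalgebra.Repr.arbitrary ℂ h), Finset.sum_add_distrib]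
  zero_mem' := fun h x => by
    simp [sweedler_eq_sum _ h (Coalgebra.Repr.arbitrary ℂ h)]
  smul_mem' := fun c ω hω h x => by
    rw [LinearMap.smul_apply, ← hω h x]
    simp [sweedler_eq_sum _ h (Coalgebra.Repr.arbitrary ℂ h), Finset.smul_sum]

theorem mem_equivariantChains (n : ℕ) (ω : Chain U A n) :
    ω ∈ equivariantChains U A n ↔ ∀ (h x : U),
      ∑ s ∈ (Coalgebra.Repr.arbitrary ℂ h).index,
        diagonalAction (n + 1) ((Coalgebra.Repr.arbitrary ℂ h).left s)
          (ω (x * (Coalgebra.Repr.arbitrary ℂ h).right s)) = ω (h * x) := by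
  refine forall_congr' fun h => forall_congr' fun x => ?_
  rw [sweedler_eq_sum _ h (Coalgebra.Repr.arbitrary ℂ h)]
  rfl

variable (U A) in
/-- The subspace `Im(1 - λ_n)` of `C_n^U(A)`. -/
def cyclicImage (n : ℕ) : Submodule ℂ (Chain U A n) :=
  (equivariantChains U A n).map (LinearMap.id - cyclicOperator n)

variable (U A) in
/-- Equivariant chains representing cycles of the complex `C_n^U(A) / Im(1 - λ_n)`. -/
def cycles : ∀ n : ℕ, Submodule ℂ (Chain U A n)
  | 0 => equivariantChains U A 0
  | n + 1 => equivariantChains U A (n + 1) ⊓ (cyclicImage U A n).comap (boundary n)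

variable (U A) in
/-- Equivariant chains representing boundaries of the complex `C_n^U(A) / Im(1 - λ_n)`. -/
def boundaries (n : ℕ) : Submodule ℂ (Chain U A n) :=
  cyclicImage U A n ⊔ (equivariantChains U A (n + 1)).map (boundary n)

variable (U A) in
/-- The equivariant cyclic homology `HC_n^U(A)`: the `n`-th homology of the complex
`C_•^U(A) / Im(1 - λ_•)` with differential induced by `b`. -/
abbrev HC (n : ℕ) : Type (max u v) :=
  cycles U A n ⧸ (boundaries U A n).comap (cycles U A n).subtype

/-- The homology class of a cycle. -/
def HC.mk (n : ℕ) (ω : Chain U A n) (hω : ω ∈ cycles U A n) : HC U A n :=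
  Submodule.Quotient.mk ⟨ω, hω⟩

end CyclicHomology

/-! ## The character -/

section Character

/-- `Tr_σ(T₀ ⊗ ⋯ ⊗ T_n)(h) = ∑ (T₀)_{i₀i₁} ⊗ ⋯ ⊗ (T_n)_{i_n i_{n+1}} σ(h)_{i₀ i_{n+1}}`. -/
def twistedTrace {N : ℕ} (σ : U →ₐ[ℂ] Matrix (Fin N) (Fin N) ℂ) (n : ℕ)
    (T : Fin (n + 1) → Matrix (Fin N) (Fin N) A) : Chain U A n :=
  ∑ i : Fin (n + 2) → Fin N,
    (Matrix.entryLinearMap ℂ ℂ (i 0) (i (Fin.last (n + 1))) ∘ₗ σ.toLinearMap).smulRight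
      (tprod (n + 1) fun k : Fin (n + 1) => T k (i k.castSucc) (i k.succ))

theorem twistedTrace_apply {N : ℕ} (σ : U →ₐ[ℂ] Matrix (Fin N) (Fin N) ℂ) (n : ℕ)
    (T : Fin (n + 1) → Matrix (Fin N) (Fin N) A) (h : U) :
    twistedTrace σ n T h = ∑ i : Fin (n + 2) → Fin N, σ h (i 0) (i (Fin.last (n + 1))) •
      tprod (n + 1) fun k : Fin (n + 1) => T k (i k.castSucc) (i k.succ) := by
  simp [twistedTrace]

/-- `Tr_σ(e^{⊗ (n+1)})`. -/
def EquivariantIdempotent.character (p : EquivariantIdempotent U A) (n : ℕ) : Chain U A n :=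
  twistedTrace p.σ n fun _ => p.e

end Character

end EquivCyclic

/-!
The twisted trace turns equivariant matrices over `A` into equivariant chains, and it behaves like
the trace of ordinary cyclic homology. With `T₀, …, T_n` intertwining `σ` with itself,

* `Tr_σ(T₀ ⊗ ⋯ ⊗ T_n)` lies in `C_n^U(A)` (`twistedTrace_mem_equivariantChains`);
* multiplying adjacent tensor factors of the trace multiplies the matrices
  (`contract_twistedTrace`);
* the twisted rotation sends it to `Tr_σ(T_n ⊗ T₀ ⊗ ⋯ ⊗ T_{n-1})` (`twistedRotate_twistedTrace`).

No antipode or cocommutativity is needed: the condition `(h₍₁₎ ▷ T) σ(h₍₂₎)ᵗ = σ(h)ᵗ T` absorbs an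
action on the last tensor factor, and coassociativity allows it to be used factor by factor.

For an idempotent `e` all faces of `Tr_σ(e^{⊗ (n+1)})` equal `Tr_σ(e^{⊗ n})`. In odd degree such a
trace is in the image of `1 - λ`, since `λ` acts on it by `-1`; this shows that the trace is a cycle
in every degree, and that its class vanishes in odd degree.

The remaining point is that in even degree the class depends only on the module. An isomorphism
between the modules of `(e, σ)` and `(f, τ)` is given by equivariant matrices `u`, `v` with
`u v = e` and `v u = f` (`exists_matrix_of_linearMap`, `matrix_mul_eq`). In matrices equivariant
for `σ ⊕ τ`, the idempotents `e ⊕ 0` and `0 ⊕ f` are joined by three affine lines, through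
`(e, 0; v, 0)` and `(0, u; 0, f)`, all of whose points are idempotent. Along such a line
`E_s = p + s θ`, the derivative of `Tr(E_s^{⊗ (n+1)})` is `(n + 1) Tr(θ ⊗ E_s^{⊗ n})` modulo
the image of `1 - λ`, and this is up to sign the boundary of `(n + 1) Tr(θ ⊗ E_s^{⊗ (n+1)})`
(`boundary_twistedTrace_update`). A linear functional which vanishes on boundaries is therefore
constant along the line (`twistedTrace_line_sub_mem`). Since the trace is additive on block sums
(`twistedTrace_blockSum`), the character is a homomorphism on the monoid of classes, and the
universal property of the Grothendieck group gives existence and uniqueness.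
-/

namespace EquivCyclic

universe u v

/-! ### Sweedler calculus and sums over paths -/

section Coassociativity

variable {U : Type u} [Ring U] [Bialgebra ℂ U]

/-- Coassociativity in the form `D(h₍₁₎₍₁₎) G(h₍₁₎₍₂₎, h₍₂₎) = D(h₍₁₎) G(h₍₂₎₍₁₎, h₍₂₎₍₂₎)`. -/
theorem sum_sweedler_left {M M' ι : Type*} [AddCommGroup M] [Module ℂ M] [AddCommGroup M']
    [Module ℂ M'] (D : U →ₗ[ℂ] M →ₗ[ℂ] M') (G : U →ₗ[ℂ] U →ₗ[ℂ] M) (h : U)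
    (r : Coalgebra.Repr ℂ h ι) :
    ∑ s ∈ r.index, ∑ t ∈ (Coalgebra.Repr.arbitrary ℂ (r.left s)).index,
      D ((Coalgebra.Repr.arbitrary ℂ (r.left s)).left t)
        (G ((Coalgebra.Repr.arbitrary ℂ (r.left s)).right t) (r.right s)) =
    ∑ s ∈ r.index, D (r.left s) (sweedler G (r.right s)) := by
  have key := congrArg (TensorProduct.lift (D.compl₂ (TensorProduct.lift G)))
    (Coalgebra.sum_tmul_tmul_eq r (fun s => Coalgebra.Repr.arbitrary ℂ (r.left s))
      (fun s => Coalgebra.Repr.arbitrary ℂ (r.right s)))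
  simp only [map_sum, TensorProduct.lift.tmul, LinearMap.compl₂_apply] at key
  rw [key]
  refine Finset.sum_congr rfl fun s _ => ?_
  rw [sweedler_eq_sum _ _ (Coalgebra.Repr.arbitrary ℂ (r.right s)), map_sum]

end Coassociativity

theorem sum_eq_sum_insertNth {κ M : Type*} [Fintype κ] [AddCommMonoid M] {m : ℕ}
    (p : Fin (m + 1)) (f : (Fin (m + 1) → κ) → M) :
    ∑ i, f i = ∑ q : Fin m → κ, ∑ l, f (p.insertNth l q) := by
  rw [← (Fin.insertNthEquiv (fun _ => κ) p).sum_comp, Fintype.sum_prod_type, Finset.sum_comm]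
  rfl

variable {U : Type u} {A : Type v} [Ring U] [Bialgebra ℂ U] [Ring A] [Algebra ℂ A]

/-! ### The twisted trace as a multilinear map -/

section Multilinear

variable {N : ℕ} (σ : U →ₐ[ℂ] Matrix (Fin N) (Fin N) ℂ)

/-- The twisted trace as a multilinear map in its matrix arguments. -/
def twistedTraceMultilinear (n : ℕ) :
    MultilinearMap ℂ (fun _ : Fin (n + 1) => Matrix (Fin N) (Fin N) A) (Chain U A n) :=
  ∑ i : Fin (n + 2) → Fin N,
    (LinearMap.smulRightₗ
      (Matrix.entryLinearMap ℂ ℂ (i 0) (i (Fin.last (n + 1))) ∘ₗ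
        σ.toLinearMap)).compMultilinearMap
      ((tprod (n + 1)).compLinearMap fun k => Matrix.entryLinearMap ℂ A (i k.castSucc) (i k.succ))

theorem twistedTraceMultilinear_apply (n : ℕ) (T : Fin (n + 1) → Matrix (Fin N) (Fin N) A) :
    (twistedTraceMultilinear σ n T : Chain U A n) = twistedTrace σ n T := by
  rw [twistedTraceMultilinear, sum_apply]
  rfl

end Multilinear

variable [Module U A] [IsScalarTower ℂ U A]

/-! ### Matrices intertwining two representations -/

section Intertwines

variable {L M N : ℕ}

/-- The matrix `T` over `A` intertwines `σ` and `τ` if `(h₍₁₎ ▷ T) τ(h₍₂₎)ᵗ = σ(h)ᵗ T` for all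
`h`. For `σ = τ` this is the condition on the idempotent of a pair. -/
def Intertwines (σ : U →ₐ[ℂ] Matrix (Fin M) (Fin M) ℂ) (τ : U →ₐ[ℂ] Matrix (Fin N) (Fin N) ℂ)
    (T : Matrix (Fin M) (Fin N) A) : Prop :=
  ∀ h : U, twistedAction τ h T = (σ h).transpose.map (algebraMap ℂ A) * T

variable {σ : U →ₐ[ℂ] Matrix (Fin M) (Fin M) ℂ} {τ : U →ₐ[ℂ] Matrix (Fin N) (Fin N) ℂ}

theorem intertwines_iff {T : Matrix (Fin M) (Fin N) A} :
    Intertwines σ τ T ↔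
      ∀ h i k, rowAction τ h (T i) k = ∑ j, σ h j i • T j k := by
  simp [Intertwines, ← Matrix.ext_iff, twistedAction, Matrix.mul_apply, Algebra.smul_def]

theorem Intertwines.sum_smul {T : Matrix (Fin M) (Fin N) A} (hT : Intertwines σ τ T) (h : U)
    {ι : Type*} (r : Coalgebra.Repr ℂ h ι) (i : Fin M) (k : Fin N) :
    ∑ s ∈ r.index, ∑ j, τ (r.right s) k j • (r.left s • T i j) = ∑ j, σ h j i • T j k := by
  rw [← rowAction_apply τ h r, intertwines_iff.1 hT]

theorem Intertwines.add {S T : Matrix (Fin M) (Fin N) A} (hS : Intertwines σ τ S)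
    (hT : Intertwines σ τ T) : Intertwines σ τ (S + T) := by
  rw [intertwines_iff] at *
  intro h i k
  change rowAction τ h (S i + T i) k = _
  simp [hS, hT, Finset.sum_add_distrib]

theorem Intertwines.smul {T : Matrix (Fin M) (Fin N) A} (c : ℂ)
    (hT : Intertwines σ τ T) : Intertwines σ τ (c • T) := by
  rw [intertwines_iff] at *
  intro h i k
  change rowAction τ h (c • T i) k = _
  simp [hT, Finset.smul_sum, smul_comm c]

theorem Intertwines.sub {S T : Matrix (Fin M) (Fin N) A} (hS : Intertwines σ τ S)
    (hT : Intertwines σ τ T) : Intertwines σ τ (S - T) := by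
  simpa [sub_eq_add_neg] using hS.add (hT.smul (-1))

theorem intertwines_zero : Intertwines σ τ (0 : Matrix (Fin M) (Fin N) A) := by
  rw [intertwines_iff]
  intro h i k
  change rowAction τ h 0 k = _
  simp

end Intertwines

/-! ### Products and rotations of factors of the twisted trace -/

section Trace

variable {N : ℕ} {σ : U →ₐ[ℂ] Matrix (Fin N) (Fin N) ℂ}

/-- Multiplying adjacent factors of the trace multiplies the corresponding matrices. -/
theorem contract_twistedTrace (n : ℕ) (i : Fin (n + 1))
    (T : Fin (n + 2) → Matrix (Fin N) (Fin N) A) (h : U) :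
    contract A n i (twistedTrace σ (n + 1) T h) = twistedTrace σ n (contractFun i T) h := by
  -- Summing first over the index between the factors `i` and `i + 1` forms the matrix product.
  rw [twistedTrace_apply, twistedTrace_apply, map_sum, sum_eq_sum_insertNth i.succ.castSucc]
  refine Finset.sum_congr rfl fun q _ => ?_
  have h0 : ∀ l : Fin N, (i.succ.castSucc.insertNth l q : Fin (n + 3) → Fin N) 0 = q 0 := by
    intro l
    have : (0 : Fin (n + 3)) = i.succ.castSucc.succAbove 0 := by
      simp [Fin.succAbove, Fin.lt_def]
    rw [this, Fin.insertNth_apply_succAbove]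
  have h1 : ∀ l : Fin N, (i.succ.castSucc.insertNth l q : Fin (n + 3) → Fin N)
      (Fin.last (n + 2)) = q (Fin.last (n + 1)) := by
    intro l
    have : Fin.last (n + 2) = i.succ.castSucc.succAbove (Fin.last (n + 1)) := by
      have := i.2
      simp [Fin.ext_iff, Fin.succAbove, Fin.lt_def]; omega
    rw [this, Fin.insertNth_apply_succAbove]
  simp only [h0, h1, map_smul, contract_tprod]
  rw [← Finset.smul_sum]
  congr 1
  have h2 : ∀ l : Fin N, contractFun i (fun k : Fin (n + 2) =>
      T k ((i.succ.castSucc.insertNth l q : Fin (n + 3) → Fin N) k.castSucc)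
        ((i.succ.castSucc.insertNth l q : Fin (n + 3) → Fin N) k.succ)) =
      Function.update (fun k => contractFun i T k (q k.castSucc) (q k.succ)) i
        (T i.castSucc (q i.castSucc) l * T i.succ l (q i.succ)) := by
    intro l
    have hlt : ∀ m : Fin (n + 3), ∀ j : Fin (n + 2), (j : ℕ) = m → (m : ℕ) < i + 1 →
        (i.succ.castSucc.insertNth l q : Fin (n + 3) → Fin N) m = q j := by
      intro m j hj hm
      have : m = i.succ.castSucc.succAbove j := by
        rw [Fin.succAbove_of_castSucc_lt _ _ (by simpa [Fin.lt_def, hj] using hm)]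
        exact Fin.ext hj.symm
      rw [this, Fin.insertNth_apply_succAbove]
    have hgt : ∀ m : Fin (n + 3), ∀ j : Fin (n + 2), (j : ℕ) + 1 = m → (i : ℕ) + 1 < m →
        (i.succ.castSucc.insertNth l q : Fin (n + 3) → Fin N) m = q j := by
      intro m j hj hm
      have : m = i.succ.castSucc.succAbove j := by
        rw [Fin.succAbove_of_le_castSucc _ _ (by simp [Fin.le_def]; omega)]
        exact Fin.ext hj.symm
      rw [this, Fin.insertNth_apply_succAbove]
    have heq : (i.succ.castSucc.insertNth l q : Fin (n + 3) → Fin N) i.succ.castSucc = l :=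
      Fin.insertNth_apply_same _ _ _
    ext k
    rcases lt_trichotomy k i with hk | hk | hk
    · rw [Function.update_of_ne hk.ne]
      simp only [contractFun, if_pos hk]
      rw [hlt _ k.castSucc (by simp) (by simp only [Fin.lt_def, Fin.val_castSucc] at hk ⊢; omega),
        hlt _ k.succ (by simp) (by simp only [Fin.lt_def, Fin.val_castSucc, Fin.val_succ] at hk ⊢; omega)]
    · subst hk
      rw [Function.update_self]
      simp only [contractFun, lt_irrefl, if_false, if_true]
      rw [hlt k.castSucc.castSucc k.castSucc (by simp) (by simp),
        hgt k.succ.succ k.succ (by simp) (by simp), Fin.succ_castSucc, heq]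
    · rw [Function.update_of_ne hk.ne']
      simp only [contractFun, if_neg hk.asymm, if_neg hk.ne']
      rw [hgt _ k.castSucc (by simp) (by simp only [Fin.lt_def, Fin.val_castSucc, Fin.val_succ] at hk ⊢; omega),
        hgt _ k.succ (by simp) (by simp only [Fin.lt_def, Fin.val_succ] at hk ⊢; omega)]
  simp only [h2]
  rw [← MultilinearMap.map_update_sum]
  congr 1
  rw [Function.update_eq_self_iff.2]
  simp [contractFun, Matrix.mul_apply]

/-- The equivariance of the last matrix turns the twist of the rotation into the representation:
the trace is cyclic for `twistedRotate`. -/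
theorem twistedRotate_twistedTrace (n : ℕ) (T : Fin (n + 1) → Matrix (Fin N) (Fin N) A)
    (hT : Intertwines σ σ (T (Fin.last n))) :
    twistedRotate n (twistedTrace σ n T : Chain U A n) =
      twistedTrace σ n (Fin.cons (T (Fin.last n)) (Fin.init T) : Fin (n + 1) → _) := by
  ext h
  rw [twistedRotate_apply n _ h (Coalgebra.Repr.arbitrary ℂ h)]
  set r := Coalgebra.Repr.arbitrary ℂ h
  simp only [twistedTrace_apply, map_sum, map_smul, rotate_tprod, factorAction_tprod]
  -- Equivariance trades the summation over the last index for one over a new first index.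
  conv_rhs => rw [sum_eq_sum_insertNth (0 : Fin (n + 2))]
  conv_lhs => simp only [sum_eq_sum_insertNth (Fin.last (n + 1)), Fin.insertNth_last']
  rw [Finset.sum_comm]
  refine Finset.sum_congr rfl fun q _ => ?_
  have h1 : ∀ (x : U) (l : Fin N), Function.update
      (Fin.cons (T (Fin.last n) ((Fin.snoc q l : Fin (n + 2) → Fin N) (Fin.last n).castSucc)
        ((Fin.snoc q l : Fin (n + 2) → Fin N) (Fin.last n).succ))
      (Fin.init fun k : Fin (n + 1) => T k ((Fin.snoc q l : Fin (n + 2) → Fin N) k.castSucc)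
        ((Fin.snoc q l : Fin (n + 2) → Fin N) k.succ)) : Fin (n + 1) → A) 0
      (x • (Fin.cons (T (Fin.last n) ((Fin.snoc q l : Fin (n + 2) → Fin N) (Fin.last n).castSucc)
        ((Fin.snoc q l : Fin (n + 2) → Fin N) (Fin.last n).succ))
      (Fin.init fun k : Fin (n + 1) => T k ((Fin.snoc q l : Fin (n + 2) → Fin N) k.castSucc)
        ((Fin.snoc q l : Fin (n + 2) → Fin N) k.succ)) : Fin (n + 1) → A) 0) =
      Function.update (Fin.cons 0 (fun k : Fin n => T k.castSucc (q k.castSucc) (q k.succ)) :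
        Fin (n + 1) → A) 0 (x • T (Fin.last n) (q (Fin.last n)) l) := by
    intro x l
    rw [Fin.cons_zero, Fin.update_cons_zero, Fin.update_cons_zero, Fin.succ_last, Fin.snoc_last,
      Fin.snoc_castSucc]
    congr 1
    ext k
    simp only [Fin.init]
    rw [Fin.snoc_castSucc, Fin.succ_castSucc, Fin.snoc_castSucc]
  have h2 : ∀ l : Fin N, (fun k : Fin (n + 1) =>
      (Fin.cons (T (Fin.last n)) (Fin.init T) : Fin (n + 1) → Matrix (Fin N) (Fin N) A) k
        ((Fin.insertNth 0 l q : Fin (n + 2) → Fin N) k.castSucc)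
        ((Fin.insertNth 0 l q : Fin (n + 2) → Fin N) k.succ)) =
      Function.update (Fin.cons 0 (fun k : Fin n => T k.castSucc (q k.castSucc) (q k.succ)) :
        Fin (n + 1) → A) 0 (T (Fin.last n) l (q 0)) := by
    intro l
    rw [Fin.update_cons_zero]
    ext k
    refine Fin.cases ?_ (fun k => ?_) k
    · simp
    · simp [Fin.init]
  simp only [h1, h2, Fin.snoc_last, ← MultilinearMap.map_update_smul,
    ← MultilinearMap.map_update_sum]
  congr 2
  have h3 : ∀ l : Fin N, (Fin.snoc q l : Fin (n + 2) → Fin N) 0 = q 0 := fun l =>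
    Fin.snoc_castSucc (α := fun _ => Fin N) l q 0
  have h4 : ∀ l : Fin N, (Fin.insertNth 0 l q : Fin (n + 2) → Fin N) (Fin.last (n + 1)) =
      q (Fin.last n) := fun l => by
    rw [← Fin.succ_last]; simp
  simp only [h3, h4]
  rw [hT.sum_smul h r]
  simp

end Trace

/-! ### Equivariance of the twisted trace -/

section PathTensor

variable {n N : ℕ}

/-- The matrix of tensors whose `(i, j)` entry is
`∑ T₀(i, l₁) ⊗ T₁(l₁, l₂) ⊗ ⋯ ⊗ T_{k-1}(l_{k-1}, j) ⊗ a_k ⊗ ⋯ ⊗ a_{n-1}`. It follows the recursion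
of `partialDiagonalAction`, which treats the last of the first `k` factors separately; the first
`k` entries of `a` are irrelevant as soon as they are overwritten. -/
def pathTensor (T : Fin n → Matrix (Fin N) (Fin N) A) :
    ∀ k : ℕ, k ≤ n → (Fin n → A) → Matrix (Fin N) (Fin N) (TPow A n)
  | 0, _, a => Matrix.diagonal fun _ => tprod n a
  | k + 1, hk, a => Matrix.of fun i j => ∑ l, pathTensor T k (Nat.le_of_succ_le hk)
      (Function.update a ⟨k, hk⟩ (T ⟨k, hk⟩ l j)) i l

theorem pathTensor_zero (T : Fin n → Matrix (Fin N) (Fin N) A) (hk : 0 ≤ n) (a : Fin n → A)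
    (i j : Fin N) : pathTensor T 0 hk a i j = if i = j then tprod n a else 0 := by
  simp [pathTensor, Matrix.diagonal_apply]

theorem pathTensor_succ (T : Fin n → Matrix (Fin N) (Fin N) A) (k : ℕ) (hk : k + 1 ≤ n)
    (a : Fin n → A) (i j : Fin N) : pathTensor T (k + 1) hk a i j =
      ∑ l, pathTensor T k (Nat.le_of_succ_le hk)
        (Function.update a ⟨k, hk⟩ (T ⟨k, hk⟩ l j)) i l := rfl

/-- A path tensor is linear in each of its unused slots. -/
theorem exists_pathTensor_update (T : Fin n → Matrix (Fin N) (Fin N) A) (k : ℕ) (hk : k ≤ n)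
    (a : Fin n → A) (m : Fin n) (hm : k ≤ m) (i j : Fin N) :
    ∃ f : A →ₗ[ℂ] TPow A n, ∀ b, pathTensor T k hk (Function.update a m b) i j = f b := by
  induction k generalizing a j with
  | zero =>
    refine ⟨if i = j then (tprod n).toLinearMap a m else 0, fun b => ?_⟩
    rw [pathTensor_zero]
    split_ifs <;> simp
  | succ k ih =>
    choose f hf using fun l => ih (Nat.le_of_succ_le hk)
      (Function.update a ⟨k, hk⟩ (T ⟨k, hk⟩ l j)) (Nat.le_of_succ_le hm) l
    refine ⟨∑ l, f l, fun b => ?_⟩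
    rw [pathTensor_succ, LinearMap.sum_apply]
    refine Finset.sum_congr rfl fun l _ => ?_
    rw [← hf, Function.update_comm (by simp [Fin.ext_iff]; omega)]

theorem factorAction_pathTensor (T : Fin n → Matrix (Fin N) (Fin N) A) (k : ℕ) (hk : k ≤ n)
    (a : Fin n → A) (m : Fin n) (hm : k ≤ m) (i j : Fin N) (h : U) :
    factorAction n m h (pathTensor T k hk a i j) =
      pathTensor T k hk (Function.update a m (h • a m)) i j := by
  induction k generalizing a j with
  | zero =>
    rw [pathTensor_zero, pathTensor_zero]
    split_ifs
    · rw [factorAction_tprod]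
    · simp
  | succ k ih =>
    rw [pathTensor_succ, pathTensor_succ, map_sum]
    have hne : m ≠ ⟨k, hk⟩ := by simp [Fin.ext_iff]; omega
    refine Finset.sum_congr rfl fun l _ => ?_
    rw [ih _ _ (Nat.le_of_succ_le hm), Function.update_comm hne,
      Function.update_of_ne hne]

/-- Applying `h₍₁₎` to the first `k` factors and `σ(h₍₂₎)` to the end point of the paths amounts to
applying `σ(h)` to their starting point: equivariance moves `σ` through the factors one by one,
from right to left. -/
theorem sweedler_partialDiagonalAction_pathTensor (σ : U →ₐ[ℂ] Matrix (Fin N) (Fin N) ℂ)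
    (T : Fin n → Matrix (Fin N) (Fin N) A) (hT : ∀ k, Intertwines σ σ (T k)) (k : ℕ) (hk : k ≤ n)
    (a : Fin n → A) (i j : Fin N) (h : U) :
    sweedler ((partialDiagonalAction n k hk).compl₂ (∑ l, (Matrix.entryLinearMap ℂ ℂ j l ∘ₗ
        σ.toLinearMap).smulRight (pathTensor T k hk a i l))) h =
      ∑ l, σ h l i • pathTensor T k hk a l j := by
  induction k generalizing a j h with
  | zero =>
    rw [sweedler_eq_sum _ h (Coalgebra.Repr.arbitrary ℂ h)]
    simp only [partialDiagonalAction, LinearMap.compl₂_apply, LinearMap.smulRight_apply,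
      LinearMap.smul_apply, LinearMap.id_apply, ← map_smul]
    rw [← map_sum, Coalgebra.sum_counit_smul]
    simp [pathTensor_zero]
  | succ k ih =>
    have hk' := Nat.le_of_succ_le hk
    -- Equivariance of `T k`: acting on the last active factor moves `σ` one step to the left.
    have hinner : ∀ x : U, sweedler ((factorAction n ⟨k, hk⟩).compl₂ (∑ l,
        (Matrix.entryLinearMap ℂ ℂ j l ∘ₗ σ.toLinearMap).smulRight
          (pathTensor T (k + 1) hk a i l))) x =
        ∑ m, (∑ l, (Matrix.entryLinearMap ℂ ℂ m l ∘ₗ σ.toLinearMap).smulRight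
          (pathTensor T k hk' (Function.update a ⟨k, hk⟩ (T ⟨k, hk⟩ m j)) i l)) x := by
      intro x
      rw [sweedler_eq_sum _ x (Coalgebra.Repr.arbitrary ℂ x)]
      set r := Coalgebra.Repr.arbitrary ℂ x
      choose f hf using fun l => exists_pathTensor_update T k hk' a ⟨k, hk⟩ le_rfl i l
      have hfac : ∀ (l : Fin N) (y : U) (b : A), factorAction n ⟨k, hk⟩ y (f l b) = f l (y • b) := fun l y b => by
        rw [← hf, factorAction_pathTensor T k hk' _ ⟨k, hk⟩ le_rfl, Function.update_self,
          Function.update_idem, hf]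
      have hsum := fun l => congrArg (f l) ((hT ⟨k, hk⟩).sum_smul x r l j)
      simp only [map_sum, map_smul] at hsum
      simp only [LinearMap.compl₂_apply, LinearMap.sum_apply, LinearMap.smulRight_apply,
        LinearMap.comp_apply, AlgHom.toLinearMap_apply, Matrix.entryLinearMap_apply, map_sum,
        map_smul, pathTensor_succ, hf, hfac, Finset.smul_sum]
      rw [Finset.sum_comm (s := Finset.univ) (t := Finset.univ)
        (f := fun m l => σ x m l • f l (T ⟨k, hk⟩ m j)), ← Finset.sum_congr rfl fun l _ => hsum l]
      rw [Finset.sum_congr rfl fun s _ => Finset.sum_comm, Finset.sum_comm]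
    rw [sweedler_eq_sum _ h (Coalgebra.Repr.arbitrary ℂ h)]
    set r := Coalgebra.Repr.arbitrary ℂ h
    -- Coassociativity groups the action on the last factor with `σ`.
    have hstep := sum_sweedler_left (partialDiagonalAction (A := A) n k hk')
      ((factorAction n ⟨k, hk⟩).compl₂ (∑ l,
        (Matrix.entryLinearMap ℂ ℂ j l ∘ₗ σ.toLinearMap).smulRight
          (pathTensor T (k + 1) hk a i l))) h r
    simp only [hinner, map_sum] at hstep
    have hl : ∀ (x : U) (w : TPow A n), partialDiagonalAction n (k + 1) hk x w =
        ∑ t ∈ (Coalgebra.Repr.arbitrary ℂ x).index,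
          partialDiagonalAction n k hk' ((Coalgebra.Repr.arbitrary ℂ x).left t)
            (factorAction n ⟨k, hk⟩ ((Coalgebra.Repr.arbitrary ℂ x).right t) w) := fun x w => by
      rw [partialDiagonalAction, sweedler_eq_sum _ x (Coalgebra.Repr.arbitrary ℂ x),
        LinearMap.sum_apply]
      rfl
    have ih' := fun l => (sweedler_eq_sum _ h r).symm.trans
      (ih hk' (Function.update a ⟨k, hk⟩ (T ⟨k, hk⟩ l j)) l h)
    simp only [LinearMap.compl₂_apply] at ih' hstep ⊢
    simp only [hl]
    rw [hstep, Finset.sum_comm]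
    simp only [ih']
    rw [Finset.sum_comm]
    simp only [pathTensor_succ, Finset.smul_sum]

/-- The path tensors as sums over paths. -/
theorem pathTensor_eq_sum (T : Fin n → Matrix (Fin N) (Fin N) A) (k : ℕ) (hk : k ≤ n)
    (a : Fin n → A) (i j : Fin N) :
    pathTensor T k hk a i j = ∑ p : Fin (k + 1) → Fin N,
      if p 0 = i ∧ p (Fin.last k) = j then tprod n (fun l => if h : l.val < k then
        T l (p ⟨l, by omega⟩) (p ⟨l + 1, by omega⟩) else a l) else 0 := by
  induction k generalizing a j with
  | zero =>
    rw [pathTensor_zero, ← (Equiv.funUnique (Fin 1) (Fin N)).symm.sum_comp]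
    simp [ite_and]
  | succ k ih =>
    rw [pathTensor_succ, sum_eq_sum_insertNth (Fin.last (k + 1))]
    simp only [ih]
    rw [Finset.sum_comm]
    refine Finset.sum_congr rfl fun p _ => ?_
    simp only [Fin.insertNth_last']
    have h0 : ∀ x : Fin N, (Fin.snoc p x : Fin (k + 2) → Fin N) 0 = p 0 := fun x =>
      Fin.snoc_castSucc (α := fun _ => Fin N) x p 0
    simp only [ite_and, Fin.snoc_last, h0]
    rw [← Finset.sum_subset (Finset.subset_univ {p (Fin.last k)}),
      ← Finset.sum_subset (Finset.subset_univ {j}), Finset.sum_singleton, Finset.sum_singleton,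
      if_pos rfl, if_pos rfl]
    · congr 2
      funext l
      rcases lt_trichotomy l.val k with hl | hl | hl
      · have h1 : (⟨l, by omega⟩ : Fin (k + 2)) = Fin.castSucc ⟨l, by omega⟩ := rfl
        have h2 : (⟨l + 1, by omega⟩ : Fin (k + 2)) = Fin.castSucc ⟨l + 1, by omega⟩ := rfl
        rw [dif_pos hl, dif_pos (by omega), h1, h2, Fin.snoc_castSucc, Fin.snoc_castSucc]
      · obtain rfl : l = ⟨k, hk⟩ := Fin.ext hl
        have h1 : (⟨k, by omega⟩ : Fin (k + 2)) = Fin.castSucc (Fin.last k) := rfl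
        have h2 : (⟨k + 1, by omega⟩ : Fin (k + 2)) = Fin.last (k + 1) := rfl
        rw [dif_neg (by simp), dif_pos (by simp), h1, h2, Fin.snoc_castSucc, Fin.snoc_last,
          Function.update_self]
      · rw [dif_neg (by omega), dif_neg (by omega),
          Function.update_of_ne (by simp [Fin.ext_iff]; omega)]
    · intro x _ hx
      rw [if_neg (c := x = j) (by simpa using hx), ite_self]
    · intro x _ hx
      rw [if_neg (c := p (Fin.last k) = x) (Ne.symm (by simpa using hx)), ite_self]

/-- The full path tensors are the coefficients of the trace; the initial value `0` of the vector `a`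
is overwritten completely. -/
theorem twistedTrace_eq_sum_pathTensor (σ : U →ₐ[ℂ] Matrix (Fin N) (Fin N) ℂ)
    (T : Fin (n + 1) → Matrix (Fin N) (Fin N) A) (h : U) :
    twistedTrace σ n T h = ∑ i, ∑ j, σ h i j • pathTensor T (n + 1) le_rfl 0 i j := by
  simp only [pathTensor_eq_sum, Finset.smul_sum, twistedTrace_apply, smul_ite, smul_zero]
  rw [Finset.sum_congr rfl fun i _ => Finset.sum_comm, Finset.sum_comm]
  refine Finset.sum_congr rfl fun p _ => ?_
  rw [Finset.sum_eq_single (p 0) (fun i _ hi => by simp [Ne.symm hi]) (by simp),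
    Finset.sum_eq_single (p (Fin.last (n + 1))) (fun j _ hj => by simp [Ne.symm hj]) (by simp),
    if_pos ⟨rfl, rfl⟩]
  congr 2
  funext l
  rw [dif_pos l.2]
  rfl

/-- The trace of equivariant matrices is an equivariant chain. -/
theorem twistedTrace_mem_equivariantChains (σ : U →ₐ[ℂ] Matrix (Fin N) (Fin N) ℂ)
    (T : Fin (n + 1) → Matrix (Fin N) (Fin N) A) (hT : ∀ k, Intertwines σ σ (T k)) :
    (twistedTrace σ n T : Chain U A n) ∈ equivariantChains U A n := by
  rw [mem_equivariantChains]
  intro h x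
  set r := Coalgebra.Repr.arbitrary ℂ h
  have key := fun i j => (sweedler_eq_sum _ h r).symm.trans
    (sweedler_partialDiagonalAction_pathTensor σ T hT (n + 1) le_rfl 0 i j h)
  simp only [twistedTrace_eq_sum_pathTensor, map_mul, Matrix.mul_apply, Finset.sum_smul]
  simp only [LinearMap.compl₂_apply, LinearMap.sum_apply, LinearMap.smulRight_apply,
    LinearMap.comp_apply, AlgHom.toLinearMap_apply, Matrix.entryLinearMap_apply, map_sum,
    map_smul] at key
  simp only [map_sum, map_smul]
  calc _ = ∑ i, ∑ m, σ x i m • ∑ s ∈ r.index, ∑ j, σ (r.right s) m j •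
        diagonalAction (n + 1) (r.left s) (pathTensor T (n + 1) le_rfl 0 i j) := by
        simp only [Finset.smul_sum, smul_smul]
        rw [Finset.sum_comm]
        refine Finset.sum_congr rfl fun i _ => ?_
        rw [Finset.sum_congr rfl fun s _ => Finset.sum_comm, Finset.sum_comm]
    _ = ∑ i, ∑ m, σ x i m • ∑ l, σ h l i • pathTensor T (n + 1) le_rfl 0 l m :=
        Finset.sum_congr rfl fun i _ => Finset.sum_congr rfl fun m _ =>
          congrArg (σ x i m • ·) (key i m)
    _ = _ := by
        simp only [Finset.smul_sum, smul_smul]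
        rw [Finset.sum_congr rfl fun i _ => Finset.sum_comm, Finset.sum_comm]
        refine Finset.sum_congr rfl fun l _ => ?_
        rw [Finset.sum_comm]
        simp only [mul_comm]

end PathTensor

/-! ### Derivatives of multilinear maps along lines -/

section Derivative

variable {V : Type*} [AddCommGroup V] [Module ℂ V]

/-- The product rule; splitting off the first argument avoids any topology on `V`. -/
theorem hasDerivAt_multilinearMap {n : ℕ} (g : MultilinearMap ℂ (fun _ : Fin n => V) ℂ)
    (x y : Fin n → V) (s : ℂ) :
    HasDerivAt (fun s : ℂ => g fun k => x k + s • y k)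
      (∑ k, g (Function.update (fun k => x k + s • y k) k (y k))) s := by
  induction n with
  | zero =>
    have h : (fun s : ℂ => g fun k => x k + s • y k) = fun _ => g x :=
      funext fun s => congrArg g (Subsingleton.elim _ _)
    rw [h]
    simpa using hasDerivAt_const s (g x)
  | succ n ih =>
    have hg : ∀ z : Fin (n + 1) → V, g z = g.curryLeft (z 0) (fun k => z k.succ) := fun z => by
      rw [MultilinearMap.curryLeft_apply]
      exact congrArg g (Fin.cons_self_tail z).symm
    have h := (ih (g.curryLeft (x 0)) (fun k => x k.succ) (fun k => y k.succ)).add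
      ((hasDerivAt_id s).mul (ih (g.curryLeft (y 0)) (fun k => x k.succ) (fun k => y k.succ)))
    refine (h.congr_deriv ?_).congr_of_eventuallyEq (Filter.Eventually.of_forall fun t => ?_)
    · rw [Fin.sum_univ_succ]
      have h0 : ∀ k : Fin n, (fun j : Fin n => Function.update (fun k => x k + s • y k) k.succ
          (y k.succ) j.succ) =
          Function.update (fun k : Fin n => x k.succ + s • y k.succ) k (y k.succ) := fun k => by
        ext j
        simp [Function.update_apply]
      simp only [hg, Function.update_self, h0, Function.update_of_ne (Fin.succ_ne_zero _).symm,
        Function.update_of_ne (Fin.succ_ne_zero _)]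
      simp only [map_add, map_smul, add_apply, smul_apply,
        Finset.sum_add_distrib, smul_eq_mul, Finset.mul_sum, id]
      ring
    · dsimp only
      rw [hg]
      simp only [map_add, map_smul, add_apply, smul_apply, smul_eq_mul, Pi.add_apply, Pi.mul_apply,
        id]

/-- A multilinear map takes the same value on the diagonal at `p` and at `p + θ`, modulo a
subspace `S` which contains its derivatives along the line through these points. -/
theorem multilinearMap_sub_mem_of_deriv_mem {W : Type*} [AddCommGroup W] [Module ℂ W] {n : ℕ}
    (f : MultilinearMap ℂ (fun _ : Fin n => V) W) (S : Submodule ℂ W) (p θ : V)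
    (h : ∀ s : ℂ, ∑ k, f (Function.update (fun _ => p + s • θ) k θ) ∈ S) :
    f (fun _ => p + θ) - f (fun _ => p) ∈ S := by
  by_contra hf
  obtain ⟨l, hl, hS⟩ := Submodule.exists_le_ker_of_notMem hf
  have hd : ∀ s : ℂ, HasDerivAt (fun s : ℂ => l (f fun _ => p + s • θ)) 0 s := fun s => by
    have := hasDerivAt_multilinearMap (l.compMultilinearMap f) (fun _ => p) (fun _ => θ) s
    refine this.congr_deriv ?_
    simp only [LinearMap.compMultilinearMap_apply, ← map_sum]
    exact hS (h s)
  have hc := is_const_of_deriv_eq_zero (fun s => (hd s).differentiableAt)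
    (fun s => (hd s).deriv) 1 0
  simp only [one_smul, zero_smul, add_zero] at hc
  exact hl (by rw [map_sub, hc, sub_self])

end Derivative

/-! ### Cycles and homotopies -/

section Homotopy

variable {N : ℕ} {σ : U →ₐ[ℂ] Matrix (Fin N) (Fin N) ℂ}

theorem face_twistedTrace_of_lt (n : ℕ) (i : Fin (n + 2)) (hi : i.val < n + 1)
    (T : Fin (n + 2) → Matrix (Fin N) (Fin N) A) :
    face n i (twistedTrace σ (n + 1) T : Chain U A (n + 1)) =
      twistedTrace σ n (contractFun ⟨i, hi⟩ T) := by
  ext h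
  rw [face, dif_pos hi]
  exact contract_twistedTrace n _ T h

theorem face_last_twistedTrace (n : ℕ) (T : Fin (n + 2) → Matrix (Fin N) (Fin N) A)
    (hT : Intertwines σ σ (T (Fin.last (n + 1)))) :
    face n (Fin.last (n + 1)) (twistedTrace σ (n + 1) T : Chain U A (n + 1)) =
      twistedTrace σ n (contractFun 0
        (Fin.cons (T (Fin.last (n + 1))) (Fin.init T) : Fin (n + 2) → _)) := by
  ext h
  rw [face, dif_neg (by simp), LinearMap.comp_apply, twistedRotate_twistedTrace _ _ hT]
  exact contract_twistedTrace n _ _ h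

theorem twistedTrace_sub_rotate_mem (n : ℕ) (T : Fin (n + 1) → Matrix (Fin N) (Fin N) A)
    (hT : ∀ k, Intertwines σ σ (T k)) :
    (twistedTrace σ n T : Chain U A n) - (-1 : ℂ) ^ n •
      twistedTrace σ n (Fin.cons (T (Fin.last n)) (Fin.init T) : Fin (n + 1) → _) ∈
        cyclicImage U A n := by
  refine ⟨_, twistedTrace_mem_equivariantChains σ T hT, ?_⟩
  rw [LinearMap.sub_apply, LinearMap.id_apply, cyclicOperator, LinearMap.smul_apply,
    twistedRotate_twistedTrace _ _ (hT _)]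

/-- In odd degree, the trace of `e ⊗ ⋯ ⊗ e` is its own negative modulo the image of `1 - λ`. -/
theorem twistedTrace_const_mem_cyclicImage {n : ℕ} (hn : Odd n) {e : Matrix (Fin N) (Fin N) A}
    (he : Intertwines σ σ e) :
    (twistedTrace σ n (fun _ => e) : Chain U A n) ∈ cyclicImage U A n := by
  have h := twistedTrace_sub_rotate_mem n (fun _ => e) (fun _ => he)
  have hc : (Fin.cons e (Fin.init fun _ : Fin (n + 1) => e) :
      Fin (n + 1) → Matrix (Fin N) (Fin N) A) = fun _ => e := by
    ext1 k
    refine Fin.cases rfl (fun _ => rfl) k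
  rw [hc, hn.neg_one_pow, neg_one_smul, sub_neg_eq_add, ← two_smul ℂ] at h
  simpa using Submodule.smul_mem _ (2⁻¹ : ℂ) h

theorem boundary_twistedTrace_const (n : ℕ) {e : Matrix (Fin N) (Fin N) A}
    (he : Intertwines σ σ e) (hee : e * e = e) :
    boundary n (twistedTrace σ (n + 1) (fun _ => e) : Chain U A (n + 1)) =
      (∑ i : Fin (n + 2), (-1 : ℂ) ^ (i : ℕ)) • twistedTrace σ n fun _ => e := by
  have hcon : ∀ (i : Fin (n + 1)), contractFun i (fun _ => e) = fun _ => e := fun i => by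
    ext1 k
    simp [contractFun, hee]
  rw [boundary, LinearMap.sum_apply, Finset.sum_smul]
  refine Finset.sum_congr rfl fun i _ => ?_
  rw [LinearMap.smul_apply]
  congr 1
  refine Fin.lastCases ?_ (fun i => ?_) i
  · rw [face_last_twistedTrace _ _ he]
    have hc : (Fin.cons e (Fin.init fun _ : Fin (n + 2) => e) :
        Fin (n + 2) → Matrix (Fin N) (Fin N) A) = fun _ => e := by
      ext1 k
      refine Fin.cases rfl (fun _ => rfl) k
    rw [hc, hcon]
  · rw [face_twistedTrace_of_lt _ _ i.2, hcon]

theorem twistedTrace_const_mem_cycles (n : ℕ) {e : Matrix (Fin N) (Fin N) A}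
    (he : Intertwines σ σ e) (hee : e * e = e) :
    (twistedTrace σ n (fun _ => e) : Chain U A n) ∈ cycles U A n := by
  cases n with
  | zero => exact twistedTrace_mem_equivariantChains σ _ fun _ => he
  | succ n =>
    refine ⟨twistedTrace_mem_equivariantChains σ _ fun _ => he, ?_⟩
    rw [SetLike.mem_coe, Submodule.mem_comap, boundary_twistedTrace_const n he hee,
      Fin.sum_neg_one_pow]
    split_ifs with h
    · simp
    · rw [one_smul]
      refine twistedTrace_const_mem_cyclicImage ?_ he
      rw [Nat.even_add] at h
      simpa using h

/-- Modulo the image of `1 - λ`, in even degree the position of `θ` in a trace of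
`E ⊗ ⋯ ⊗ θ ⊗ ⋯ ⊗ E` does not matter. -/
theorem twistedTrace_update_sub_mem {n : ℕ} (hn : Even n) {E θ : Matrix (Fin N) (Fin N) A}
    (hE : Intertwines σ σ E) (hθ : Intertwines σ σ θ) (k : Fin (n + 1)) :
    (twistedTrace σ n (Function.update (fun _ => E) 0 θ) : Chain U A n) -
      twistedTrace σ n (Function.update (fun _ => E) k θ) ∈ cyclicImage U A n := by
  induction k using Fin.induction with
  | zero => simp
  | succ k ih =>
    have h := twistedTrace_sub_rotate_mem (σ := σ) n (Function.update (fun _ => E) k.castSucc θ)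
      (fun j => by rw [Function.update_apply]; split_ifs <;> assumption)
    have hc : (Fin.cons (Function.update (fun _ => E) k.castSucc θ (Fin.last n))
        (Fin.init (Function.update (fun _ => E) k.castSucc θ)) :
        Fin (n + 1) → Matrix (Fin N) (Fin N) A) = Function.update (fun _ => E) k.succ θ := by
      ext1 j
      refine Fin.cases ?_ (fun j => ?_) j
      · simp [Fin.ext_iff, k.2.ne']
      · simp [Function.update_apply, Fin.init]
    rw [hc, hn.neg_one_pow, one_smul] at h
    simpa using Submodule.add_mem _ ih h

/-- If `E` is idempotent, `θ E = α θ` and `E θ = β θ`, then `θ ⊗ E ⊗ ⋯ ⊗ E` is up to the factor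
`α - β` the boundary of the same expression one degree higher: only the two faces adjacent to `θ`
survive the alternating sum. -/
theorem boundary_twistedTrace_update {n : ℕ} (hn : Even n) {E θ : Matrix (Fin N) (Fin N) A}
    (hE : Intertwines σ σ E) (hEE : E * E = E) {α β : ℂ} (hα : θ * E = α • θ)
    (hβ : E * θ = β • θ) :
    boundary n (twistedTrace σ (n + 1) (Function.update (fun _ => E) 0 θ) : Chain U A (n + 1)) =
      (α - β) • twistedTrace σ n (Function.update (fun _ => E) 0 θ) := by
  have hsmul : ∀ c : ℂ, (twistedTrace σ n (Function.update (fun _ => E) 0 (c • θ)) :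
      Chain U A n) = c • twistedTrace σ n (Function.update (fun _ => E) 0 θ) := fun c => by
    rw [← twistedTraceMultilinear_apply, ← twistedTraceMultilinear_apply,
      MultilinearMap.map_update_smul]
  have h0 : face n 0 (twistedTrace σ (n + 1) (Function.update (fun _ => E) 0 θ) :
      Chain U A (n + 1)) = α • twistedTrace σ n (Function.update (fun _ => E) 0 θ) := by
    rw [face_twistedTrace_of_lt _ _ (by simp), ← hsmul, ← hα]
    congr 1
    ext1 k
    refine Fin.cases ?_ (fun k => ?_) k <;>
      simp [contractFun]
  have hmid : ∀ i : Fin n, face n i.succ.castSucc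
      (twistedTrace σ (n + 1) (Function.update (fun _ => E) 0 θ) : Chain U A (n + 1)) =
        twistedTrace σ n (Function.update (fun _ => E) 0 θ) := fun i => by
    rw [face_twistedTrace_of_lt _ _ (by simp)]
    congr 1
    ext1 k
    refine Fin.cases ?_ (fun k => ?_) k <;>
      simp [contractFun, hEE]
  have hlast : face n (Fin.last (n + 1))
      (twistedTrace σ (n + 1) (Function.update (fun _ => E) 0 θ) : Chain U A (n + 1)) =
        β • twistedTrace σ n (Function.update (fun _ => E) 0 θ) := by
    rw [face_last_twistedTrace _ _ (by simpa using hE), ← hsmul, ← hβ]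
    congr 1
    ext1 k
    refine Fin.cases ?_ (fun k => ?_) k
    · simp [contractFun, Fin.init]
    · simp [contractFun, Fin.init]
  rw [boundary, LinearMap.sum_apply, Fin.sum_univ_castSucc, Fin.sum_univ_succ]
  simp only [LinearMap.smul_apply, Fin.castSucc_zero, h0, hmid, hlast]
  rw [← Finset.sum_smul]
  have hs : ∑ i : Fin n, (-1 : ℂ) ^ ((i.succ.castSucc : Fin (n + 2)) : ℕ) = 0 := by
    simp only [Fin.val_castSucc, Fin.val_succ, pow_succ, ← Finset.sum_mul, Fin.sum_neg_one_pow,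
      if_pos hn, zero_mul]
  rw [hs, Fin.val_last, hn.add_one.neg_one_pow]
  simp [sub_eq_add_neg, add_smul]

/-- Homotopy invariance along an affine line of equivariant idempotents `E_s = p + s θ`, on which
`θ E_s = α θ` and `E_s θ = β θ` with `α ≠ β`: the derivative of the trace of `E_s ⊗ ⋯ ⊗ E_s` is a
boundary for every `s`. -/
theorem twistedTrace_line_sub_mem {n : ℕ} (hn : Even n) {p θ : Matrix (Fin N) (Fin N) A}
    (hp : Intertwines σ σ p) (hθ : Intertwines σ σ θ)
    (hE : ∀ s : ℂ, (p + s • θ) * (p + s • θ) = p + s • θ) {α β : ℂ} (hαβ : α ≠ β)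
    (hα : ∀ s : ℂ, θ * (p + s • θ) = α • θ) (hβ : ∀ s : ℂ, (p + s • θ) * θ = β • θ) :
    (twistedTrace σ n (fun _ => p + θ) : Chain U A n) - twistedTrace σ n (fun _ => p) ∈
      boundaries U A n := by
  rw [← twistedTraceMultilinear_apply, ← twistedTraceMultilinear_apply]
  refine multilinearMap_sub_mem_of_deriv_mem _ _ p θ fun s => Submodule.sum_mem _ fun k _ => ?_
  rw [twistedTraceMultilinear_apply]
  have hEs : Intertwines σ σ (p + s • θ) := hp.add (hθ.smul s)
  have h1 := twistedTrace_update_sub_mem hn hEs hθ k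
  have h2 : (twistedTrace σ n (Function.update (fun _ => p + s • θ) 0 θ) : Chain U A n) ∈
      boundaries U A n := by
    have hb : boundary n (twistedTrace σ (n + 1) (Function.update (fun _ => p + s • θ) 0 θ) :
        Chain U A (n + 1)) ∈ boundaries U A n :=
      Submodule.mem_sup_right ⟨_, twistedTrace_mem_equivariantChains σ _
        (fun j => by rw [Function.update_apply]; split_ifs <;> assumption), rfl⟩
    rw [boundary_twistedTrace_update hn hEs (hE s) (hα s) (hβ s)] at hb
    rwa [Submodule.smul_mem_iff _ (sub_ne_zero.2 hαβ)] at hb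
  simpa using Submodule.sub_mem _ h2 (Submodule.mem_sup_left h1)

/-- Idempotents with `p q = p` and `q p = q` have homologous traces. -/
theorem twistedTrace_sub_mem_of_left {n : ℕ} (hn : Even n) {p q : Matrix (Fin N) (Fin N) A}
    (hp : Intertwines σ σ p) (hq : Intertwines σ σ q) (hpp : p * p = p) (hqq : q * q = q)
    (hpq : p * q = p) (hqp : q * p = q) :
    (twistedTrace σ n (fun _ => q) : Chain U A n) - twistedTrace σ n (fun _ => p) ∈
      boundaries U A n := by
  have h := twistedTrace_line_sub_mem (p := p) (θ := q - p) hn hp (hq.sub hp) (α := 1) (β := 0)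
    (fun s => by simp [mul_add, add_mul, mul_sub, sub_mul, hpp, hqq, hpq, hqp]) one_ne_zero
    (fun s => by simp [mul_add, mul_sub, sub_mul, hpp, hqq, hpq, hqp])
    (fun s => by simp [add_mul, mul_sub, sub_mul, hpp, hqq, hpq, hqp])
  simpa using h

/-- Idempotents with `p q = q` and `q p = p` have homologous traces. -/
theorem twistedTrace_sub_mem_of_right {n : ℕ} (hn : Even n) {p q : Matrix (Fin N) (Fin N) A}
    (hp : Intertwines σ σ p) (hq : Intertwines σ σ q) (hpp : p * p = p) (hqq : q * q = q)
    (hpq : p * q = q) (hqp : q * p = p) :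
    (twistedTrace σ n (fun _ => q) : Chain U A n) - twistedTrace σ n (fun _ => p) ∈
      boundaries U A n := by
  have h := twistedTrace_line_sub_mem (p := p) (θ := q - p) hn hp (hq.sub hp) (α := 0) (β := 1)
    (fun s => by simp [mul_add, add_mul, mul_sub, sub_mul, hpp, hqq, hpq, hqp]) zero_ne_one
    (fun s => by simp [mul_add, mul_sub, sub_mul, hpp, hqq, hpq, hqp])
    (fun s => by simp [add_mul, mul_sub, sub_mul, hpp, hqq, hpq, hqp])
  simpa using h

end Homotopy

/-! ### Block matrices -/

section Blocks

variable {M N : ℕ}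

/-- The square matrix of size `M + N` with the given blocks. -/
def blocks {R : Type*} (a : Matrix (Fin M) (Fin M) R) (b : Matrix (Fin M) (Fin N) R)
    (c : Matrix (Fin N) (Fin M) R) (d : Matrix (Fin N) (Fin N) R) :
    Matrix (Fin (M + N)) (Fin (M + N)) R :=
  Matrix.reindex finSumFinEquiv finSumFinEquiv (Matrix.fromBlocks a b c d)

theorem blockSum_eq_blocks {R : Type*} [Zero R] (a : Matrix (Fin M) (Fin M) R)
    (d : Matrix (Fin N) (Fin N) R) : blockSum a d = blocks a 0 0 d := rfl

theorem blocks_mul {R : Type*} [Ring R] (a a' : Matrix (Fin M) (Fin M) R)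
    (b b' : Matrix (Fin M) (Fin N) R) (c c' : Matrix (Fin N) (Fin M) R)
    (d d' : Matrix (Fin N) (Fin N) R) :
    blocks a b c d * blocks a' b' c' d' =
      blocks (a * a' + b * c') (a * b' + b * d') (c * a' + d * c') (c * b' + d * d') := by
  simp [blocks, Matrix.fromBlocks_multiply]

theorem intertwines_blocks {σ : U →ₐ[ℂ] Matrix (Fin M) (Fin M) ℂ}
    {τ : U →ₐ[ℂ] Matrix (Fin N) (Fin N) ℂ} {a : Matrix (Fin M) (Fin M) A}
    {b : Matrix (Fin M) (Fin N) A} {c : Matrix (Fin N) (Fin M) A} {d : Matrix (Fin N) (Fin N) A}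
    (ha : Intertwines σ σ a) (hb : Intertwines σ τ b) (hc : Intertwines τ σ c)
    (hd : Intertwines τ τ d) : Intertwines (repSum σ τ) (repSum σ τ) (blocks a b c d) := by
  rw [intertwines_iff] at *
  intro h i k
  refine Fin.addCases (fun i => ?_) (fun i => ?_) i <;>
    refine Fin.addCases (fun k => ?_) (fun k => ?_) k
  · rw [rowAction_repSum_left]
    simpa [blocks, Fin.sum_univ_add, repSum_apply] using ha h i k
  · rw [rowAction_repSum_right]
    simpa [blocks, Fin.sum_univ_add, repSum_apply] using hb h i k
  · rw [rowAction_repSum_left]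
    simpa [blocks, Fin.sum_univ_add, repSum_apply] using hc h i k
  · rw [rowAction_repSum_right]
    simpa [blocks, Fin.sum_univ_add, repSum_apply] using hd h i k

/-- A path which visits both blocks has a vanishing factor, so the trace of a block-diagonal matrix
is the sum of the traces of its blocks. -/
theorem twistedTrace_blockSum (σ : U →ₐ[ℂ] Matrix (Fin M) (Fin M) ℂ)
    (τ : U →ₐ[ℂ] Matrix (Fin N) (Fin N) ℂ) (n : ℕ) (S : Fin (n + 1) → Matrix (Fin M) (Fin M) A)
    (T : Fin (n + 1) → Matrix (Fin N) (Fin N) A) :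
    (twistedTrace (repSum σ τ) n (fun k => blockSum (S k) (T k)) : Chain U A n) =
      twistedTrace σ n S + twistedTrace τ n T := by
  ext h
  rw [LinearMap.add_apply, twistedTrace_apply, twistedTrace_apply, twistedTrace_apply]
  refine ((Fintype.sum_sumElim _ _).symm.trans ?_).symm
  refine Fintype.sum_of_injective (Sum.elim (fun p k => Fin.castAdd N (p k))
    (fun p k => Fin.natAdd M (p k))) ?_ _ _ (fun i hi => ?_) ?_
  · refine Function.Injective.sumElim (fun p q hpq => ?_) (fun p q hpq => ?_) (fun p q hpq => ?_)
    · exact funext fun k => Fin.castAdd_injective M N (congrFun hpq k)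
    · exact funext fun k => Fin.natAdd_injective N M (congrFun hpq k)
    · have := congrArg Fin.val (congrFun hpq 0)
      simp at this
      omega
  · by_contra hne
    have hstep : ∀ k : Fin (n + 1), (i k.castSucc).val < M ↔ (i k.succ).val < M := by
      intro k
      by_contra hk
      refine hne ?_
      rw [(tprod (n + 1)).map_coord_zero k, smul_zero]
      generalize i k.castSucc = x at hk
      generalize i k.succ = y at hk
      revert hk
      refine Fin.addCases (fun x => ?_) (fun x => ?_) x <;>
        refine Fin.addCases (fun y => ?_) (fun y => ?_) y <;> simp
    have hall : ∀ k : Fin (n + 2), (i 0).val < M ↔ (i k).val < M := fun k =>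
      Fin.induction Iff.rfl (fun k ih => ih.trans (hstep k)) k
    refine hi ?_
    by_cases h0 : (i 0).val < M
    · exact ⟨Sum.inl fun k => ⟨i k, (hall k).1 h0⟩, rfl⟩
    · refine ⟨Sum.inr fun k => ⟨i k - M, ?_⟩, funext fun k => Fin.ext ?_⟩
      · have := (hall k).not.1 h0
        omega
      · have := (hall k).not.1 h0
        simp
        omega
  · rintro (p | p) <;> simp [repSum_apply]

end Blocks

/-! ### Invariance under isomorphism and the character on K-theory -/

namespace EquivariantIdempotent

variable {n : ℕ}

theorem intertwines_e (p : EquivariantIdempotent U A) : Intertwines p.σ p.σ p.e := p.equivariant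

theorem character_mem_cycles (p : EquivariantIdempotent U A) (n : ℕ) :
    p.character n ∈ cycles U A n :=
  twistedTrace_const_mem_cycles n p.intertwines_e p.idem

theorem character_directSum (p q : EquivariantIdempotent U A) (n : ℕ) :
    (p.directSum q).character n = p.character n + q.character n :=
  twistedTrace_blockSum p.σ q.σ n (fun _ => p.e) (fun _ => q.e)

theorem character_zero (n : ℕ) : (zero : EquivariantIdempotent U A).character n = 0 := by
  have : IsEmpty (Fin (zero : EquivariantIdempotent U A).N) := inferInstanceAs (IsEmpty (Fin 0))
  rw [character, twistedTrace, Finset.univ_eq_empty, Finset.sum_empty]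

/-- Mutually inverse equivariant matrices `u ∈ e Mat(A) f` and `v ∈ f Mat(A) e` connect `e ⊕ 0` to
`0 ⊕ f` through three affine lines of idempotents, with the corners `(e, 0; v, 0)` and
`(0, u; 0, f)`. -/
theorem character_sub_mem_of_inverse (hn : Even n) {p q : EquivariantIdempotent U A}
    {x : Matrix (Fin p.N) (Fin q.N) A} {y : Matrix (Fin q.N) (Fin p.N) A}
    (hx : Intertwines p.σ q.σ x) (hy : Intertwines q.σ p.σ y) (hxy : x * y = p.e)
    (hyx : y * x = q.e) (hpx : p.e * x = x) (hxq : x * q.e = x) (hqy : q.e * y = y)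
    (hyp : y * p.e = y) :
    q.character n - p.character n ∈ boundaries U A n := by
  have e0 : Intertwines (repSum p.σ q.σ) (repSum p.σ q.σ) (blocks p.e 0 0 0) :=
    intertwines_blocks p.intertwines_e intertwines_zero intertwines_zero intertwines_zero
  have e1 : Intertwines (repSum p.σ q.σ) (repSum p.σ q.σ) (blocks p.e 0 y 0) :=
    intertwines_blocks p.intertwines_e intertwines_zero hy intertwines_zero
  have e2 : Intertwines (repSum p.σ q.σ) (repSum p.σ q.σ) (blocks 0 x 0 q.e) :=
    intertwines_blocks intertwines_zero hx intertwines_zero q.intertwines_e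
  have e3 : Intertwines (repSum p.σ q.σ) (repSum p.σ q.σ) (blocks 0 0 0 q.e) :=
    intertwines_blocks intertwines_zero intertwines_zero intertwines_zero q.intertwines_e
  -- `e0` and `e1` differ by a change of column, `e1` and `e2` by a change of row, `e2` and `e3` by
  -- a change of column.
  have h1 := twistedTrace_sub_mem_of_left hn e0 e1 (by simp [blocks_mul, p.idem])
    (by simp [blocks_mul, p.idem, hyp]) (by simp [blocks_mul, p.idem])
    (by simp [blocks_mul, p.idem, hyp])
  have h2 := twistedTrace_sub_mem_of_right hn e1 e2 (by simp [blocks_mul, p.idem, hyp])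
    (by simp [blocks_mul, q.idem, hxq]) (by simp [blocks_mul, hpx, hyx])
    (by simp [blocks_mul, hxy, hqy])
  have h3 := twistedTrace_sub_mem_of_left hn e2 e3 (by simp [blocks_mul, q.idem, hxq])
    (by simp [blocks_mul, q.idem]) (by simp [blocks_mul, q.idem, hxq])
    (by simp [blocks_mul, q.idem])
  have h := Submodule.add_mem _ (Submodule.add_mem _ h3 h2) h1
  have z : ∀ {N : ℕ} (ρ : U →ₐ[ℂ] Matrix (Fin N) (Fin N) ℂ),
      (twistedTrace ρ n (fun _ => 0) : Chain U A n) = 0 := fun ρ => by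
    rw [← twistedTraceMultilinear_apply]
    exact (twistedTraceMultilinear ρ n).map_zero
  simp only [sub_add_sub_cancel, ← blockSum_eq_blocks, twistedTrace_blockSum, z, zero_add,
    add_zero] at h
  exact h

/-- The inclusion of `A^N e` into `A^N`. -/
def incl (p : EquivariantIdempotent U A) : p.Mod →ₗ[A] (Fin p.N → A) := p.range.subtype

/-- The rows of `e` as elements of `A^N e`; they generate it over `A`. -/
def row (p : EquivariantIdempotent U A) (i : Fin p.N) : p.Mod := ⟨p.e i, p.row_mem_range i⟩

theorem incl_injective (p : EquivariantIdempotent U A) : Function.Injective p.incl :=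
  Subtype.val_injective

theorem incl_row (p : EquivariantIdempotent U A) (i : Fin p.N) : p.incl (p.row i) = p.e i := rfl

theorem incl_vecMul (p : EquivariantIdempotent U A) (w : p.Mod) :
    Matrix.vecMul (p.incl w) p.e = p.incl w := w.2

theorem sum_incl_smul_row (p : EquivariantIdempotent U A) (w : p.Mod) :
    ∑ i, p.incl w i • p.row i = w := by
  refine p.incl_injective ?_
  conv_rhs => rw [← incl_vecMul, Matrix.vecMul_eq_sum]
  simp only [map_sum, map_smul, incl_row]

/-- The matrices of mutually inverse morphisms multiply to the idempotents. -/
theorem matrix_mul_eq {p q : EquivariantIdempotent U A} {φ : p.Mod → q.Mod} {ψ : q.Mod → p.Mod}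
    {x : Matrix (Fin p.N) (Fin q.N) A} {y : Matrix (Fin q.N) (Fin p.N) A}
    (hφ : ∀ w, q.incl (φ w) = Matrix.vecMul (p.incl w) x)
    (hψ : ∀ w, p.incl (ψ w) = Matrix.vecMul (q.incl w) y) (h : ∀ w, ψ (φ w) = w)
    (hpx : p.e * x = x) : x * y = p.e := by
  rw [← hpx, Matrix.mul_assoc]
  funext i
  rw [Matrix.mul_apply_eq_vecMul, ← Matrix.vecMul_vecMul, ← incl_row, ← hφ, ← hψ, h]

variable [IsModuleAlgebra U A]

theorem incl_smul (p : EquivariantIdempotent U A) (h : U) (w : p.Mod) :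
    p.incl (h • w) = rowAction p.σ h (p.incl w) := rfl

/-- A morphism of equivariant projective modules is right multiplication by the matrix whose rows
are the images of the rows of the idempotent. -/
theorem exists_matrix_of_linearMap {p q : EquivariantIdempotent U A} (φ : p.Mod →ₗ[A] q.Mod)
    (hφ : ∀ (h : U) (w : p.Mod), φ (h • w) = h • φ w) :
    ∃ x : Matrix (Fin p.N) (Fin q.N) A, Intertwines p.σ q.σ x ∧ p.e * x = x ∧ x * q.e = x ∧
      ∀ w : p.Mod, q.incl (φ w) = Matrix.vecMul (p.incl w) x := by
  have hval : ∀ w : p.Mod, q.incl (φ w) =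
      Matrix.vecMul (p.incl w) (Matrix.of fun i => q.incl (φ (p.row i))) := by
    intro w
    conv_lhs => rw [← p.sum_incl_smul_row w]
    rw [Matrix.vecMul_eq_sum]
    simp only [map_sum, map_smul]
    rfl
  refine ⟨Matrix.of fun i => q.incl (φ (p.row i)), intertwines_iff.2 fun h i k => ?_,
    funext fun i => ?_, funext fun i => q.incl_vecMul (φ (p.row i)), hval⟩
  · have hrow : h • p.row i = ∑ j, algebraMap ℂ A (p.σ h j i) • p.row j := p.incl_injective (by
      rw [incl_smul, incl_row, rowAction_row]
      simp only [map_sum, map_smul, incl_row, algebraMap_smul])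
    have h1 := congrArg q.incl (hφ h (p.row i))
    rw [hrow, incl_smul] at h1
    simp only [map_sum, map_smul] at h1
    refine (congrFun h1 k).symm.trans ?_
    simp [Algebra.smul_def]
  · exact (hval (p.row i)).symm

/-- The class of the character depends only on the equivariant projective module. -/
theorem character_sub_mem_boundaries {p q : EquivariantIdempotent U A}
    (h : ModuleEquivalent U A p.Mod q.Mod) (n : ℕ) :
    q.character n - p.character n ∈ boundaries U A n := by
  rcases Nat.even_or_odd n with hn | hn
  · obtain ⟨φ, hφ⟩ := h
    obtain ⟨x, hx, hpx, hxq, hφx⟩ := exists_matrix_of_linearMap φ.toLinearMap hφ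
    obtain ⟨y, hy, hqy, hyp, hφy⟩ := exists_matrix_of_linearMap φ.symm.toLinearMap
      fun h w => by
        change φ.symm _ = h • φ.symm w
        rw [LinearEquiv.symm_apply_eq, hφ, LinearEquiv.apply_symm_apply]
    exact character_sub_mem_of_inverse hn hx hy
      (matrix_mul_eq hφx hφy φ.symm_apply_apply hpx) (matrix_mul_eq hφy hφx φ.apply_symm_apply hqy)
      hpx hxq hqy hyp
  · exact Submodule.mem_sup_left (Submodule.sub_mem _
      (twistedTrace_const_mem_cyclicImage hn q.intertwines_e)
      (twistedTrace_const_mem_cyclicImage hn p.intertwines_e))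

end EquivariantIdempotent

/-- The character on the monoid of equivalence classes of pairs. -/
def V.character [IsModuleAlgebra U A] (n : ℕ) : V U A →+ HC U A n where
  toFun := Quotient.lift (fun p => HC.mk n (p.character n) (p.character_mem_cycles n))
    fun p q hpq => by
      refine ((Submodule.Quotient.eq _).2 ?_).symm
      exact EquivariantIdempotent.character_sub_mem_boundaries hpq n
  map_zero' := (Submodule.Quotient.mk_eq_zero _).2 (by
    rw [Submodule.mem_comap]
    change EquivariantIdempotent.character _ n ∈ _
    rw [EquivariantIdempotent.character_zero]
    exact Submodule.zero_mem _)
  map_add' x y := by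
    induction x using Quotient.inductionOn with | _ p
    induction y using Quotient.inductionOn with | _ q
    exact congrArg Submodule.Quotient.mk (Subtype.ext (p.character_directSum q n))

end EquivCyclic

theorem mainTheorem7 {U : Type*} {A : Type*} [Ring U] [Bialgebra ℂ U] [Ring A] [Algebra ℂ A]
    [Module U A] [IsScalarTower ℂ U A] [EquivCyclic.IsModuleAlgebra U A] (n : ℕ) :
    ∃ hcycle : ∀ p : EquivCyclic.EquivariantIdempotent U A,
        p.character n ∈ EquivCyclic.cycles U A n,
      ∃! ch : EquivCyclic.K0 U A →+ EquivCyclic.HC U A n,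
        ∀ p : EquivCyclic.EquivariantIdempotent U A,
          ch (EquivCyclic.K0.of p) = EquivCyclic.HC.mk n (p.character n) (hcycle p) := by
  refine ⟨fun p => p.character_mem_cycles n,
    Algebra.GrothendieckAddGroup.lift (EquivCyclic.V.character n), fun p => ?_, fun ch hch => ?_⟩
  · exact DFunLike.congr_fun (Algebra.GrothendieckAddGroup.lift.symm_apply_apply
      (EquivCyclic.V.character n)) (EquivCyclic.V.mk p)
  · rw [← Equiv.symm_apply_eq]
    ext x
    induction x using Quotient.inductionOn with | _ p
    exact hch p
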